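/- Let $\lambda_0,\mu_0,\rho_0,\omega>0$, $c_P=\sqrt{(\lambda_0+2\mu_0)/\rho_0}$, $c_S=\sqrt{\mu_0/\rho_0}$, $\kappa_\alpha=\omega/c_\alpha$ and $b_\alpha=(2\rho_0\omega c_\alpha)^2\kappa_\alpha$ for $\alpha\in\{P,S\}$. Let $K\ge 0$ and $N_s,N_r$ be integers with $2K+1\le N_s,N_r$. Sources: for a fixed angle $\theta_0\in\mathbb{R}$, let the $s$-th plane wave have direction of incidence $(\cos\theta_{d_s},\sin\theta_{d_s})$ with $\theta_{d_s}=2\pi s/N_s+\theta_0$, $s=1,\dots,N_s$. Put $d^\beta_m(s)=\frac{i}{4\rho_0\omega^2}a^\beta_m(s)$ with $a_m^\beta(s)=-\frac{i}{\rho_0c_\beta^2\kappa_\beta}e^{im(\pi/2-\theta_{d_s})}$, that is, $d^\beta_m(s)=b_\beta^{-1}e^{im(\pi/2-\theta_{d_s})}$. Let $\mathbf X^\beta=(d^\beta_m(s))_{1\le s\le N_s,\,-K\le m\le K}$ and $$\mathbf X=\begin{pmatrix}\mathbf X^P&0\\0&\mathbf X^S\end{pmatrix}\in\mathbb C^{2N_s\times(4K+2)}.$$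 Receivers: for $R>0$ let $x_r=R(\cos(2\pi r/N_r),\sin(2\pi r/N_r))$, $r=1,\dots,N_r$, and let $d_r,d_r^\perp\in\mathbb{R}^2$ be orthogonal unit vectors not depending on $R$. Let $v_m(x,\kappa)=H^{(1)}_m(\kappa|x|)e^{im\varphi_x}$, where $\varphi_x$ is the polar angle of $x$ and $H^{(1)}_m$ is the Hankel function of the first kind, and put $\mathbf H^P_m=\nabla v_m(\cdot,\kappa_P)$ and $\mathbf H^S_m=(\partial_2,-\partial_1)^\top v_m(\cdot,\kappa_S)$. Let $(\mathbf Y^\alpha_\parallel)_{rn}=\overline{\mathbf H^\alpha_n(x_r)}\cdot d_r$, $(\mathbf Y^\alpha_\perp)_{rn}=\overline{\mathbf H^\alpha_n(x_r)}\cdot d_r^\perp$ for $1\le r\le N_r$, $-K\le n\le K$, and $$\mathbf Y=\begin{pmatrix}\mathbf Y^P_\parallel&\mathbf Y^S_\parallel\\ \mathbf Y^P_\perp&\mathbf Y^S_\perp\end{pmatrix}\in\mathbb C^{2N_r\times(4K+2)}.$$ With $g^P_m=\kappa_P (H^{(1)}_m)'(\kappa_PR)$ and $h^S_m=-\kappa_S(H^{(1)}_m)'(\kappa_SR)$,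 let $$\mathbf Z_{\mathbf X}=\mathrm{diag}\big(|b_P|^{-2}I_{2K+1},\,|b_S|^{-2}I_{2K+1}\big),\qquad \mathbf Z_{\mathbf Y}=\mathrm{diag}\big(|g^P_{-K}|^2,\dots,|g^P_K|^2,|h^S_{-K}|^2,\dots,|h^S_K|^2\big),$$ and let $\mathbf L(\mathbf M)=\mathbf X\mathbf M\mathbf Y^*$ for $\mathbf M\in\mathbb C^{(4K+2)\times(4K+2)}$ ($\mathbf Y$, $\mathbf Z_{\mathbf Y}$ and $\mathbf L$ depend on $R$). Suppose that $\mathbf X$ has full rank, and that $\mathbf Y$ has full rank for all sufficiently large $R$. Then, as $R\to\infty$, $\mathbf L$ has the left pseudo-inverse $$\mathbf L^\dagger(\mathbf A)=\frac1{N_sN_r}\mathbf Z_{\mathbf X}^{-1}\mathbf X^*\mathbf A\mathbf Y\mathbf Z_{\mathbf Y}^{-1},\qquad \mathbf A\in\mathbb C^{2N_s\times2N_r},$$ in the following sense: $\mathbf Z_{\mathbf X}$ is invertible and $\mathbf Z_{\mathbf Y}$ is invertible for all sufficiently large $R$; $\lim_{R\to\infty}\mathbf L^\dagger(\mathbf L(\mathbf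 M))=\mathbf M$ for every $\mathbf M\in\mathbb C^{(4K+2)\times(4K+2)}$; and, for all sufficiently large $R$, $\mathbf L\mathbf L^\dagger$ is self-adjoint with respect to the Frobenius inner product on $\mathbb C^{2N_s\times2N_r}$. -/

import Mathlib

open Filter Topology

noncomputable section

namespace ElasticScattering

/-- The Bessel function `J_n` of the first kind of integer order, given by Bessel's integral
`J_n(t) = (1/π) ∫_0^π cos (nθ - t sin θ) dθ`. -/
def besselJ (n : ℤ) (t : ℝ) : ℝ :=
  (1 / Real.pi) * ∫ θ in (0 : ℝ)..Real.pi, Real.cos (n * θ - t * Real.sin θ)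

/-- The Bessel function `Y_n` of the second kind of integer order on `t > 0`, given by
Schläfli's integral
`Y_n(t) = (1/π) ∫_0^π sin (t sin θ - nθ) dθ
  - (1/π) ∫_0^∞ (exp (ns) + (-1)^n exp (-ns)) exp (-t sinh s) ds`. -/
def besselY (n : ℤ) (t : ℝ) : ℝ :=
  (1 / Real.pi) * (∫ θ in (0 : ℝ)..Real.pi, Real.sin (t * Real.sin θ - n * θ))
    - (1 / Real.pi) * ∫ s in Set.Ioi (0 : ℝ),
        (Real.exp (n * s) + (-1 : ℝ) ^ n * Real.exp (-(n * s))) * Real.exp (-(t * Real.sinh s))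

/-- The Hankel function of the first kind, `H^{(1)}_n = J_n + i Y_n`. -/
def hankel1 (n : ℤ) (t : ℝ) : ℂ :=
  (besselJ n t : ℂ) + Complex.I * (besselY n t : ℂ)

/-- The two elastic wave modes: pressure and shear. -/
inductive WaveMode where
  | P : WaveMode
  | S : WaveMode

/-- A homogeneous isotropic elastic background with Lamé parameters `lam`, `mu` and density
`rho`, together with an angular frequency `omega`. -/
structure Background where
  lam : ℝ
  mu : ℝ
  rho : ℝ
  omega : ℝ
  lam_pos : 0 < lam
  mu_pos : 0 < mu
  rho_pos : 0 < rho
  omega_pos : 0 < omega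

namespace Background

/-- The wave speeds `c_P = √((λ + 2μ)/ρ)` and `c_S = √(μ/ρ)`. -/
def speed (B : Background) : WaveMode → ℝ
  | WaveMode.P => Real.sqrt ((B.lam + 2 * B.mu) / B.rho)
  | WaveMode.S => Real.sqrt (B.mu / B.rho)

/-- The wave numbers `κ_α = ω / c_α`. -/
def kappa (B : Background) (α : WaveMode) : ℝ :=
  B.omega / B.speed α

/-- `b_β = (2 ρ ω c_β)² κ_β`. -/
def b (B : Background) (β : WaveMode) : ℝ :=
  (2 * B.rho * B.omega * B.speed β) ^ 2 * B.kappa β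

/-- The multipole coefficient `a^β_m` of the plane wave of mode `β` whose direction of incidence
is `(cos θ, sin θ)`. -/
def planeCoeff (B : Background) (β : WaveMode) (m : ℤ) (θ : ℝ) : ℂ :=
  -(Complex.I / ((B.rho * B.speed β ^ 2 * B.kappa β : ℝ) : ℂ))
    * Complex.exp (Complex.I * (m : ℂ) * ((Real.pi / 2 - θ : ℝ) : ℂ))

/-- `d^β_m = i a^β_m / (4 ρ ω²)`. -/
def dCoeff (B : Background) (β : WaveMode) (m : ℤ) (θ : ℝ) : ℂ :=
  Complex.I / ((4 * B.rho * B.omega ^ 2 : ℝ) : ℂ) * B.planeCoeff β m θ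

end Background

/-- The Euclidean plane. -/
abbrev Plane := EuclideanSpace ℝ (Fin 2)

/-- The partial derivative `∂_{j+1} f` of a complex function on the plane. -/
def partialDeriv (j : Fin 2) (f : Plane → ℂ) (x : Plane) : ℂ :=
  fderiv ℝ f x (EuclideanSpace.single j (1 : ℝ))

/-- The gradient `(∂₁ f, ∂₂ f)`. -/
def grad (f : Plane → ℂ) (x : Plane) : Fin 2 → ℂ :=
  ![partialDeriv 0 f x, partialDeriv 1 f x]

/-- The vector curl `(∂₂ f, -∂₁ f)`. -/
def vcurl (f : Plane → ℂ) (x : Plane) : Fin 2 → ℂ :=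
  ![partialDeriv 1 f x, -partialDeriv 0 f x]

/-- `v_m(x, κ) = H^{(1)}_m(κ|x|) e^{imφ_x}`, where `e^{iφ_x} = (x₁ + i x₂)/|x|`. -/
def outgoing (m : ℤ) (κ : ℝ) (x : Plane) : ℂ :=
  hankel1 m (κ * ‖x‖) * (((x 0 : ℂ) + Complex.I * (x 1 : ℂ)) / (‖x‖ : ℂ)) ^ m

/-- The exterior cylindrical eigenvectors `H^P_m = ∇ v_m(·, κ_P)` and
`H^S_m = ∇_⊥ × v_m(·, κ_S)` of the Lamé system. -/
def extField (B : Background) : WaveMode → ℤ → Plane → Fin 2 → ℂ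
  | WaveMode.P, m, x => grad (outgoing m (B.kappa WaveMode.P)) x
  | WaveMode.S, m, x => vcurl (outgoing m (B.kappa WaveMode.S)) x

/-- `conj(u) · d` for a complex vector `u` and a real vector `d`. -/
def conjDot (u : Fin 2 → ℂ) (d : Plane) : ℂ :=
  ∑ j, (starRingEnd ℂ) (u j) * (d j : ℂ)

/-- The `j`-th (counted from `1`) of `N` equally spaced angles, `2πj/N`. -/
def gridAngle (N : ℕ) (j : Fin N) : ℝ :=
  2 * Real.pi * ((j : ℝ) + 1) / N

/-- The point with polar angle `2πj/N` on the circle of radius `R` around the origin. -/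
def circlePoint (N : ℕ) (R : ℝ) (j : Fin N) : Plane :=
  !₂[R * Real.cos (gridAngle N j), R * Real.sin (gridAngle N j)]

/-- The indices `-K, …, K`, enumerated by `Fin (2K+1)`. -/
def order (K : ℕ) (i : Fin (2 * K + 1)) : ℤ :=
  (i : ℤ) - (K : ℤ)

/-- The index type, of cardinality `4K+2`, of the block matrices. -/
abbrev BlockIdx (K : ℕ) := Fin (2 * K + 1) ⊕ Fin (2 * K + 1)

/-- `(X^β)_{sm} = d^β_m(s)`, when the `s`-th direction of incidence has polar angle
`2πs/N_s + θ₀`. -/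
def Xblock (B : Background) (K Ns : ℕ) (θ₀ : ℝ) (β : WaveMode) :
    Matrix (Fin Ns) (Fin (2 * K + 1)) ℂ :=
  Matrix.of fun s i => B.dCoeff β (order K i) (gridAngle Ns s + θ₀)

/-- The `2N_s × (4K+2)` matrix `X`. -/
def Xmat (B : Background) (K Ns : ℕ) (θ₀ : ℝ) :
    Matrix (Fin Ns ⊕ Fin Ns) (BlockIdx K) ℂ :=
  Matrix.fromBlocks (Xblock B K Ns θ₀ WaveMode.P) 0 0 (Xblock B K Ns θ₀ WaveMode.S)

/-- The matrix with entries `conj(H^α_n(x_r)) · e_r`, for a direction `e_r` at each receiver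
`x_r`. -/
def Yblock (B : Background) (K Nr : ℕ) (R : ℝ) (e : Fin Nr → Plane) (α : WaveMode) :
    Matrix (Fin Nr) (Fin (2 * K + 1)) ℂ :=
  Matrix.of fun r i => conjDot (extField B α (order K i) (circlePoint Nr R r)) (e r)

/-- The `2N_r × (4K+2)` matrix `Y`, for the directions of reception `d`, `dperp`. -/
def Ymat (B : Background) (K Nr : ℕ) (d dperp : Fin Nr → Plane) (R : ℝ) :
    Matrix (Fin Nr ⊕ Fin Nr) (BlockIdx K) ℂ :=
  Matrix.fromBlocks
    (Yblock B K Nr R d WaveMode.P) (Yblock B K Nr R d WaveMode.S)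
    (Yblock B K Nr R dperp WaveMode.P) (Yblock B K Nr R dperp WaveMode.S)

/-- The diagonal matrix `Z_X` with blocks `|b_P|⁻² I` and `|b_S|⁻² I`. -/
def ZX (B : Background) (K : ℕ) : Matrix (BlockIdx K) (BlockIdx K) ℂ :=
  Matrix.fromBlocks
    (Matrix.diagonal fun _ => ((|B.b WaveMode.P| ^ 2 : ℝ) : ℂ)⁻¹) 0
    0 (Matrix.diagonal fun _ => ((|B.b WaveMode.S| ^ 2 : ℝ) : ℂ)⁻¹)

/-- `g^P_m = κ_P (H^{(1)}_m)'(κ_P R)`. -/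
def gP (B : Background) (R : ℝ) (m : ℤ) : ℂ :=
  (B.kappa WaveMode.P : ℂ) * deriv (hankel1 m) (B.kappa WaveMode.P * R)

/-- `h^S_m = -κ_S (H^{(1)}_m)'(κ_S R)`. -/
def hS (B : Background) (R : ℝ) (m : ℤ) : ℂ :=
  -(B.kappa WaveMode.S : ℂ) * deriv (hankel1 m) (B.kappa WaveMode.S * R)

/-- The diagonal matrix `Z_Y` with blocks `C^{P,P} = diag(g^P_m conj(g^P_m))` and
`D^{S,S} = diag(h^S_m conj(h^S_m))`, `m = -K, …, K`. -/
def ZY (B : Background) (K : ℕ) (R : ℝ) : Matrix (BlockIdx K) (BlockIdx K) ℂ :=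
  Matrix.fromBlocks
    (Matrix.diagonal fun i => gP B R (order K i) * (starRingEnd ℂ) (gP B R (order K i))) 0
    0 (Matrix.diagonal fun i => hS B R (order K i) * (starRingEnd ℂ) (hS B R (order K i)))

/-- The linear operator `L(M) = X M Y^*`. -/
def Lop (B : Background) (K Ns Nr : ℕ) (θ₀ : ℝ) (d dperp : Fin Nr → Plane) (R : ℝ) :
    Matrix (BlockIdx K) (BlockIdx K) ℂ →ₗ[ℂ] Matrix (Fin Ns ⊕ Fin Ns) (Fin Nr ⊕ Fin Nr) ℂ where
  toFun M := Xmat B K Ns θ₀ * M * (Ymat B K Nr d dperp R).conjTranspose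
  map_add' M N := by rw [Matrix.mul_add, Matrix.add_mul]
  map_smul' c M := by simp

/-- The linear operator `L†(A) = (N_s N_r)⁻¹ Z_X⁻¹ X^* A Y Z_Y⁻¹`. -/
def Ldag (B : Background) (K Ns Nr : ℕ) (θ₀ : ℝ) (d dperp : Fin Nr → Plane) (R : ℝ) :
    Matrix (Fin Ns ⊕ Fin Ns) (Fin Nr ⊕ Fin Nr) ℂ →ₗ[ℂ] Matrix (BlockIdx K) (BlockIdx K) ℂ where
  toFun A := (1 / ((Ns : ℂ) * (Nr : ℂ))) •
    ((ZX B K)⁻¹ * (Xmat B K Ns θ₀).conjTranspose * A * Ymat B K Nr d dperp R * (ZY B K R)⁻¹)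
  map_add' A A' := by simp only [Matrix.mul_add, Matrix.add_mul, smul_add]
  map_smul' c A := by
    simp only [Matrix.mul_smul, Matrix.smul_mul, RingHom.id_apply]
    rw [smul_comm]

/-- The Frobenius inner product `⟨A, A'⟩ = tr(A^* A')`. -/
def frobInner {m n : Type*} [Fintype m] [Fintype n] (A A' : Matrix m n ℂ) : ℂ :=
  (A.conjTranspose * A').trace

end ElasticScattering

end

/-! Everything reduces to two Gram matrices, since `L†(L(M))` is `(N_s N_r)⁻¹ Z_X⁻¹ (X^* X) M (Y^*
Y) Z_Y⁻¹`. The grids have at least `2K+1` points, so the characters `e^{imφ}`, `|m| ≤ K`, are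
orthogonal on them. Hence `X^* X = N_s Z_X` exactly, and what remains is `N_r⁻¹ Y^* Y Z_Y⁻¹ → 1`
(`Ldag_Lop`, `tendsto_normalized_gram`).

At each receiver the two directions form an orthonormal basis, so they drop out of `Y^* Y`. In the
polar frame the field of order `m` is `e^{imφ}` times a radial and a tangential coefficient
independent of `φ`. Orthogonality of characters then leaves only entries of equal order
(`Ymat_conjTranspose_mul_self_apply`). One coefficient of each mode is the leading `g^P_m` or
`h^S_m`, of size `R^{-1/2}`; the other is `i m R⁻¹ H_m`, of size `R^{-3/2}`. After division by `Z_Y`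
the diagonal tends to `1` and the P–S coupling to `0`.

These sizes require that `√t e^{-it} H_n(t)` and the same expression for `H_n'` have nonzero limits.
The first comes from the integral representation by stationary phase and the Fresnel integral, the
second from `2 H_n' = H_{n-1} - H_{n+1}`.

Self-adjointness is algebraic: `L L†` is a real multiple of `A ↦ P A Q` with `P` and `Q` Hermitian.
-/

namespace ElasticScattering

/-! ### Hankel functions of large argument -/

/-- The finite-range part `∫_0^π exp (i (t sin θ - n θ)) dθ` of `π H^{(1)}_n(t)`. -/
noncomputable def hankelOsc (n : ℤ) (t : ℝ) : ℂ :=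
  ∫ θ in (0 : ℝ)..Real.pi, Complex.exp (Complex.I * ((t * Real.sin θ - n * θ : ℝ) : ℂ))

/-- The exponentially decaying part of Schläfli's integral. -/
noncomputable def hankelDecay (n : ℤ) (t : ℝ) : ℝ :=
  ∫ s in Set.Ioi (0 : ℝ),
    (Real.exp (n * s) + (-1 : ℝ) ^ n * Real.exp (-(n * s))) * Real.exp (-(t * Real.sinh s))

/-- `J_n` and the finite-range part of `Y_n` are the real and imaginary parts of a single
exponential integral. -/
theorem hankel1_eq (n : ℤ) (t : ℝ) :
    hankel1 n t = (1 / Real.pi : ℝ) * hankelOsc n t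
      - Complex.I * (1 / Real.pi : ℝ) * (hankelDecay n t : ℂ) := by
  have h : hankelOsc n t = ((∫ θ in (0 : ℝ)..Real.pi, Real.cos (n * θ - t * Real.sin θ) : ℝ) : ℂ)
      + Complex.I * ((∫ θ in (0 : ℝ)..Real.pi, Real.sin (t * Real.sin θ - n * θ) : ℝ) : ℂ) := by
    rw [← intervalIntegral.integral_ofReal, ← intervalIntegral.integral_ofReal,
      ← intervalIntegral.integral_const_mul, ← intervalIntegral.integral_add]
    · refine intervalIntegral.integral_congr fun θ _ => ?_
      rw [mul_comm Complex.I, Complex.exp_mul_I, ← Complex.ofReal_cos, ← Complex.ofReal_sin,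
        ← Real.cos_neg (_ - _), neg_sub, mul_comm Complex.I]
    · exact (by fun_prop : Continuous _).intervalIntegrable _ _
    · exact (by fun_prop : Continuous _).intervalIntegrable _ _
  rw [h, hankel1, besselJ, besselY, hankelDecay]
  push_cast
  ring

/-- Differentiation under the integral produces `i sin θ = (e^{iθ} - e^{-iθ}) / 2`, which shifts the
order by one in each direction. -/
theorem hasDerivAt_hankelOsc (n : ℤ) (t : ℝ) :
    HasDerivAt (hankelOsc n) ((hankelOsc (n - 1) t - hankelOsc (n + 1) t) / 2) t := by
  have key := intervalIntegral.hasDerivAt_integral_of_dominated_loc_of_deriv_le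
    (μ := MeasureTheory.volume) (a := 0) (b := Real.pi) (x₀ := t) (s := Set.univ)
    (F := fun t θ => Complex.exp (Complex.I * ((t * Real.sin θ - n * θ : ℝ) : ℂ)))
    (F' := fun t θ => Complex.exp (Complex.I * ((t * Real.sin θ - n * θ : ℝ) : ℂ))
      * (Complex.I * (Real.sin θ : ℂ)))
    (bound := fun _ => 1) Filter.univ_mem
    (Filter.Eventually.of_forall fun t =>
      (by fun_prop : Continuous _).aestronglyMeasurable)
    ((by fun_prop : Continuous _).intervalIntegrable _ _)
    ((by fun_prop : Continuous _).aestronglyMeasurable)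
    (MeasureTheory.ae_of_all _ fun θ _ t _ => by
      rw [norm_mul, mul_comm Complex.I, Complex.norm_exp_ofReal_mul_I, norm_mul, Complex.norm_I,
        Complex.norm_real, Real.norm_eq_abs, one_mul, one_mul]
      exact Real.abs_sin_le_one θ)
    (by simp)
    (MeasureTheory.ae_of_all _ fun θ _ t _ => by
      have h1 : HasDerivAt (fun t : ℝ => t * Real.sin θ - n * θ) (Real.sin θ) t := by
        simpa using ((hasDerivAt_id t).mul_const (Real.sin θ)).sub_const (n * θ)
      exact (h1.ofReal_comp.const_mul Complex.I).cexp)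
  refine HasDerivAt.congr_deriv (f := hankelOsc n) key.2 (Eq.symm ?_)
  rw [hankelOsc, hankelOsc, ← intervalIntegral.integral_sub, ← intervalIntegral.integral_div]
  · refine intervalIntegral.integral_congr fun θ _ => ?_
    have e1 : Complex.I * ((t * Real.sin θ - (n - 1 : ℤ) * θ : ℝ) : ℂ)
        = Complex.I * ((t * Real.sin θ - n * θ : ℝ) : ℂ) + θ * Complex.I := by
      push_cast; ring
    have e2 : Complex.I * ((t * Real.sin θ - (n + 1 : ℤ) * θ : ℝ) : ℂ)
        = Complex.I * ((t * Real.sin θ - n * θ : ℝ) : ℂ) + (-θ) * Complex.I := by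
      push_cast; ring
    rw [e1, e2, Complex.exp_add, Complex.exp_add, Complex.exp_mul_I, Complex.exp_mul_I,
      Complex.cos_neg, Complex.sin_neg, Complex.ofReal_sin]
    ring
  · exact (by fun_prop : Continuous _).intervalIntegrable _ _
  · exact (by fun_prop : Continuous _).intervalIntegrable _ _

theorem norm_decay_kernel_le (n : ℤ) {t s : ℝ} (hs : 0 ≤ s) (ht : 0 ≤ t) :
    ‖(Real.exp (n * s) + (-1 : ℝ) ^ n * Real.exp (-(n * s))) * Real.exp (-(t * Real.sinh s))‖
      ≤ 2 * Real.exp (-((t - |(n : ℝ)|) * s)) := by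
  have h1 : ‖Real.exp (n * s) + (-1 : ℝ) ^ n * Real.exp (-(n * s))‖
      ≤ 2 * Real.exp (|(n : ℝ)| * s) := by
    refine (norm_add_le _ _).trans ?_
    rw [norm_mul, norm_zpow, norm_neg, norm_one, one_zpow, one_mul, Real.norm_eq_abs,
      Real.norm_eq_abs, Real.abs_exp, Real.abs_exp]
    have a1 : Real.exp (n * s) ≤ Real.exp (|(n : ℝ)| * s) :=
      Real.exp_le_exp.2 (mul_le_mul_of_nonneg_right (le_abs_self _) hs)
    have a2 : Real.exp (-(n * s)) ≤ Real.exp (|(n : ℝ)| * s) := by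
      rw [← neg_mul]
      exact Real.exp_le_exp.2 (mul_le_mul_of_nonneg_right (neg_le_abs _) hs)
    linarith
  have h2 : ‖Real.exp (-(t * Real.sinh s))‖ ≤ Real.exp (-(t * s)) := by
    rw [Real.norm_eq_abs, Real.abs_exp]
    exact Real.exp_le_exp.2
      (neg_le_neg (mul_le_mul_of_nonneg_left (Real.self_le_sinh_iff.2 hs) ht))
  rw [norm_mul]
  calc _ ≤ 2 * Real.exp (|(n : ℝ)| * s) * Real.exp (-(t * s)) :=
        mul_le_mul h1 h2 (norm_nonneg _) (by positivity)
    _ = _ := by rw [mul_assoc, ← Real.exp_add]; congr 2; ring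

theorem continuous_decay_kernel (n : ℤ) (t : ℝ) :
    Continuous fun s : ℝ => (Real.exp (n * s) + (-1 : ℝ) ^ n * Real.exp (-(n * s)))
      * Real.exp (-(t * Real.sinh s)) := by
  have := Real.continuous_sinh
  fun_prop

theorem integrableOn_exp_neg_mul {c : ℝ} (hc : 0 < c) :
    MeasureTheory.IntegrableOn (fun s : ℝ => 2 * Real.exp (-(c * s))) (Set.Ioi 0) := by
  simp only [← neg_mul]
  exact (exp_neg_integrableOn_Ioi 0 hc).const_mul 2

theorem integrableOn_decay_kernel (n : ℤ) {t : ℝ} (ht : |(n : ℝ)| < t) :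
    MeasureTheory.IntegrableOn (fun s : ℝ =>
      (Real.exp (n * s) + (-1 : ℝ) ^ n * Real.exp (-(n * s))) * Real.exp (-(t * Real.sinh s)))
      (Set.Ioi 0) := by
  refine MeasureTheory.Integrable.mono' (integrableOn_exp_neg_mul (sub_pos.2 ht))
    (continuous_decay_kernel n t).aestronglyMeasurable ?_
  refine (MeasureTheory.ae_restrict_iff' measurableSet_Ioi).2 (MeasureTheory.ae_of_all _ ?_)
  exact fun s hs => norm_decay_kernel_le n (le_of_lt hs) ((abs_nonneg _).trans ht.le)

theorem abs_hankelDecay_le (n : ℤ) {t : ℝ} (ht : |(n : ℝ)| < t) :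
    |hankelDecay n t| ≤ 2 / (t - |(n : ℝ)|) := by
  have hc := sub_pos.2 ht
  rw [hankelDecay, ← Real.norm_eq_abs]
  refine (MeasureTheory.norm_integral_le_of_norm_le (integrableOn_exp_neg_mul hc) ?_).trans
    (le_of_eq ?_)
  · refine (MeasureTheory.ae_restrict_iff' measurableSet_Ioi).2 (MeasureTheory.ae_of_all _ ?_)
    exact fun s hs => norm_decay_kernel_le n (le_of_lt hs) ((abs_nonneg _).trans ht.le)
  · rw [MeasureTheory.integral_const_mul]
    have := integral_exp_mul_Ioi (a := -(t - |(n : ℝ)|)) (by linarith) 0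
    simp only [neg_mul] at this
    rw [this]
    simp [div_eq_mul_inv, neg_inv]

/-- Since `(-1)^{n±1} = -(-1)^n`, the factor `-sinh s` shifts orders exactly as `i sin θ` does, so
both parts of `H_n` obey one recurrence. -/
theorem decay_kernel_recurrence (n : ℤ) (t s : ℝ) :
    ((Real.exp ((n - 1 : ℤ) * s) + (-1 : ℝ) ^ (n - 1) * Real.exp (-((n - 1 : ℤ) * s)))
        * Real.exp (-(t * Real.sinh s))
      - (Real.exp ((n + 1 : ℤ) * s) + (-1 : ℝ) ^ (n + 1) * Real.exp (-((n + 1 : ℤ) * s)))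
        * Real.exp (-(t * Real.sinh s))) / 2
    = (Real.exp (n * s) + (-1 : ℝ) ^ n * Real.exp (-(n * s)))
        * (Real.exp (-(t * Real.sinh s)) * -Real.sinh s) := by
  have e1 : (((n - 1 : ℤ) : ℝ) * s) = n * s + -s := by push_cast; ring
  have e2 : (((n + 1 : ℤ) : ℝ) * s) = n * s + s := by push_cast; ring
  rw [e1, e2, neg_add, neg_add, neg_neg, Real.exp_add, Real.exp_add, Real.exp_add, Real.exp_add,
    zpow_sub_one₀ (by norm_num), zpow_add_one₀ (by norm_num), Real.sinh_eq s]
  norm_num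
  ring

/-- By the recurrence, the differentiated kernel is controlled by those of orders `n ± 1`. Beyond
`|n| + 2` their decay rate is at least `1`, so `2 e^{-s}` dominates uniformly. -/
theorem hasDerivAt_hankelDecay (n : ℤ) {t : ℝ} (ht : |(n : ℝ)| + 2 < t) :
    HasDerivAt (hankelDecay n) ((hankelDecay (n - 1) t - hankelDecay (n + 1) t) / 2) t := by
  have hn := abs_nonneg (n : ℝ)
  have hm : |((n - 1 : ℤ) : ℝ)| ≤ |(n : ℝ)| + 1 := by
    push_cast; exact (abs_sub _ _).trans (by simp)
  have hp : |((n + 1 : ℤ) : ℝ)| ≤ |(n : ℝ)| + 1 := by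
    push_cast; exact (abs_add_le _ _).trans (by simp)
  have hI : ∀ t' : ℝ, |(n : ℝ)| + 2 < t' → ∀ s : ℝ, 0 < s →
      ‖(Real.exp (n * s) + (-1 : ℝ) ^ n * Real.exp (-(n * s)))
        * (Real.exp (-(t' * Real.sinh s)) * -Real.sinh s)‖ ≤ 2 * Real.exp (-(1 * s)) := by
    intro t' ht' s hs
    have b1 := norm_decay_kernel_le (n - 1) hs.le (by linarith : 0 ≤ t')
    have b2 := norm_decay_kernel_le (n + 1) hs.le (by linarith : 0 ≤ t')
    have c1 : Real.exp (-((t' - |((n - 1 : ℤ) : ℝ)|) * s)) ≤ Real.exp (-(1 * s)) :=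
      Real.exp_le_exp.2 (neg_le_neg (mul_le_mul_of_nonneg_right (by linarith) hs.le))
    have c2 : Real.exp (-((t' - |((n + 1 : ℤ) : ℝ)|) * s)) ≤ Real.exp (-(1 * s)) :=
      Real.exp_le_exp.2 (neg_le_neg (mul_le_mul_of_nonneg_right (by linarith) hs.le))
    rw [← decay_kernel_recurrence, norm_div, Real.norm_ofNat]
    have := norm_sub_le
      ((Real.exp ((n - 1 : ℤ) * s) + (-1 : ℝ) ^ (n - 1) * Real.exp (-((n - 1 : ℤ) * s)))
        * Real.exp (-(t' * Real.sinh s)))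
      ((Real.exp ((n + 1 : ℤ) * s) + (-1 : ℝ) ^ (n + 1) * Real.exp (-((n + 1 : ℤ) * s)))
        * Real.exp (-(t' * Real.sinh s)))
    linarith
  have key := hasDerivAt_integral_of_dominated_loc_of_deriv_le
    (μ := MeasureTheory.volume.restrict (Set.Ioi (0 : ℝ))) (x₀ := t)
    (s := Set.Ioi (|(n : ℝ)| + 2))
    (F := fun t s => (Real.exp (n * s) + (-1 : ℝ) ^ n * Real.exp (-(n * s)))
      * Real.exp (-(t * Real.sinh s)))
    (F' := fun t s => (Real.exp (n * s) + (-1 : ℝ) ^ n * Real.exp (-(n * s)))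
        * (Real.exp (-(t * Real.sinh s)) * -Real.sinh s))
    (bound := fun s => 2 * Real.exp (-(1 * s))) (Ioi_mem_nhds ht)
    (Filter.Eventually.of_forall fun t =>
      (continuous_decay_kernel n t).aestronglyMeasurable)
    (integrableOn_decay_kernel n (by linarith))
    ((by have := Real.continuous_sinh; fun_prop : Continuous _).aestronglyMeasurable)
    ((MeasureTheory.ae_restrict_iff' measurableSet_Ioi).2
      (MeasureTheory.ae_of_all _ fun s hs t' ht' => hI t' ht' s hs))
    (integrableOn_exp_neg_mul one_pos)
    (MeasureTheory.ae_of_all _ fun s t' _ => by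
      have h1 : HasDerivAt (fun t : ℝ => -(t * Real.sinh s)) (-Real.sinh s) t' := by
        simpa using ((hasDerivAt_id t').mul_const (Real.sinh s)).fun_neg
      exact h1.exp.const_mul _)
  refine HasDerivAt.congr_deriv (f := hankelDecay n) key.2 (Eq.symm ?_)
  rw [hankelDecay, hankelDecay, ← MeasureTheory.integral_sub, ← MeasureTheory.integral_div]
  · exact MeasureTheory.integral_congr_ae
      (Filter.Eventually.of_forall fun s => decay_kernel_recurrence n t s)
  · exact integrableOn_decay_kernel _ (by linarith)
  · exact integrableOn_decay_kernel _ (by linarith)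

theorem hasDerivAt_hankel1 (n : ℤ) {t : ℝ} (ht : |(n : ℝ)| + 2 < t) :
    HasDerivAt (hankel1 n) ((hankel1 (n - 1) t - hankel1 (n + 1) t) / 2) t := by
  have h := ((hasDerivAt_hankelOsc n t).const_mul ((1 / Real.pi : ℝ) : ℂ)).sub
    ((hasDerivAt_hankelDecay n ht).ofReal_comp.const_mul (Complex.I * ((1 / Real.pi : ℝ) : ℂ)))
  rw [show hankel1 n = _ from funext (hankel1_eq n), hankel1_eq, hankel1_eq]
  refine h.congr_deriv ?_
  push_cast
  ring

/-! ### Stationary phase for the oscillatory part -/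

/-- An oscillatory integral whose amplitude vanishes at the stationary point of the phase
`t cos u` is `O(1/t)`. -/
theorem exists_norm_integral_exp_cos_mul_sin_le {q : ℝ → ℂ} {a b : ℝ}
    (hq : ∀ u ∈ Set.uIcc a b, ContDiffAt ℝ 1 q u) :
    ∃ C : ℝ, ∀ t : ℝ, 0 < t →
      ‖∫ u in a..b, q u * (Complex.exp (Complex.I * ((t * Real.cos u : ℝ) : ℂ)) * (Real.sin u : ℂ))‖
        ≤ C / t := by
  have hq' : ContinuousOn (deriv q) (Set.uIcc a b) := fun u hu =>
    ((((hq u hu).fderiv_right (m := 0) (by norm_num)).continuousAt).clm_apply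
      (continuousAt_const (y := (1 : ℝ)))).continuousWithinAt
  obtain ⟨D, hD⟩ := isCompact_uIcc.exists_bound_of_continuousOn hq'
  refine ⟨‖q b‖ + ‖q a‖ + D * |b - a|, fun t ht => ?_⟩
  have hv : ∀ u : ℝ, HasDerivAt
      (fun u : ℝ => Complex.exp (Complex.I * ((t * Real.cos u : ℝ) : ℂ)))
      (Complex.exp (Complex.I * ((t * Real.cos u : ℝ) : ℂ))
        * (Complex.I * ((t * -Real.sin u : ℝ) : ℂ))) u := fun u =>
    (((Real.hasDerivAt_cos u).const_mul t).ofReal_comp.const_mul Complex.I).cexp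
  have hn : ∀ u : ℝ, ‖Complex.exp (Complex.I * ((t * Real.cos u : ℝ) : ℂ))‖ = 1 := fun u => by
    rw [mul_comm, Complex.norm_exp_ofReal_mul_I]
  -- Up to the factor `-it`, `exp (i t cos u) sin u` is the derivative of `exp (i t cos u)`;
  -- integrating by parts gains `1/t`.
  have key := intervalIntegral.integral_mul_deriv_eq_deriv_mul (a := a) (b := b)
    (fun u hu => ((hq u hu).differentiableAt (by norm_num)).hasDerivAt) (fun u _ => hv u)
    hq'.intervalIntegrable ((by fun_prop : Continuous _).intervalIntegrable _ _)
  have e : ∫ u in a..b, q u * (Complex.exp (Complex.I * ((t * Real.cos u : ℝ) : ℂ))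
        * (Complex.I * ((t * -Real.sin u : ℝ) : ℂ)))
      = -(Complex.I * t) * ∫ u in a..b,
        q u * (Complex.exp (Complex.I * ((t * Real.cos u : ℝ) : ℂ)) * (Real.sin u : ℂ)) := by
    rw [← intervalIntegral.integral_const_mul]
    refine intervalIntegral.integral_congr fun u _ => ?_
    push_cast
    ring
  rw [e] at key
  have h3 : ‖∫ u in a..b, deriv q u * Complex.exp (Complex.I * ((t * Real.cos u : ℝ) : ℂ))‖
      ≤ D * |b - a| :=
    intervalIntegral.norm_integral_le_of_norm_le_const fun u hu => by
      rw [norm_mul, hn, mul_one]; exact hD u (Set.uIoc_subset_uIcc hu)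
  have h4 := congrArg norm key
  rw [norm_mul, norm_neg, norm_mul, Complex.norm_I, one_mul, Complex.norm_real,
    Real.norm_of_nonneg ht.le] at h4
  rw [le_div_iff₀ ht, mul_comm, h4]
  refine (norm_sub_le _ _).trans (add_le_add ((norm_sub_le _ _).trans (le_of_eq ?_)) h3)
  rw [norm_mul, norm_mul, hn, hn, mul_one, mul_one]

/-- The integral `∫_{-π/2}^{π/2} exp (i (t cos u - μ u)) du`. -/
noncomputable def oscInt (μ t : ℝ) : ℂ :=
  ∫ u in -(Real.pi / 2)..(Real.pi / 2), Complex.exp (Complex.I * ((t * Real.cos u - μ * u : ℝ) : ℂ))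

/-- The substitution `θ = π/2 + u` moves the stationary point of `t sin θ` to `u = 0`. -/
theorem hankelOsc_eq (n : ℤ) (t : ℝ) :
    hankelOsc n t = Complex.exp (-(Complex.I * (n * (Real.pi / 2)))) * oscInt n t := by
  have h := intervalIntegral.integral_comp_add_left (a := -(Real.pi / 2)) (b := Real.pi / 2)
    (fun θ => Complex.exp (Complex.I * ((t * Real.sin θ - n * θ : ℝ) : ℂ))) (Real.pi / 2)
  rw [add_neg_cancel, add_halves] at h
  rw [hankelOsc, ← h, oscInt, ← intervalIntegral.integral_const_mul]
  refine intervalIntegral.integral_congr fun u _ => ?_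
  rw [← Complex.exp_add, add_comm (Real.pi / 2) u, Real.sin_add_pi_div_two]
  congr 1
  push_cast
  ring

/-- The amplitudes differ by `-2i sin (u/4) e^{-i(μu + u/4)}`, which vanishes at the stationary
point. Writing `sin (u/4) = sin u / (4 cos (u/4) cos (u/2))`, with no zero of the denominator on
`|u| ≤ π/2`, exposes the factor `sin u`. -/
theorem exists_norm_oscInt_sub_le (μ : ℝ) :
    ∃ C : ℝ, ∀ t : ℝ, 0 < t → ‖oscInt (μ + 1 / 2) t - oscInt μ t‖ ≤ C / t := by
  have hc : ∀ u ∈ Set.uIcc (-(Real.pi / 2)) (Real.pi / 2),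
      0 < Real.cos (u / 4) ∧ 0 < Real.cos (u / 2) := by
    intro u hu
    rw [Set.uIcc_of_le (by linarith [Real.pi_pos])] at hu
    constructor <;> apply Real.cos_pos_of_mem_Ioo <;> constructor <;>
      linarith [hu.1, hu.2, Real.pi_pos]
  obtain ⟨C, hC⟩ := exists_norm_integral_exp_cos_mul_sin_le
    (a := -(Real.pi / 2)) (b := Real.pi / 2)
    (q := fun u => Complex.exp (-(Complex.I * ((μ * u + u / 4 : ℝ) : ℂ))) * (-Complex.I / 2)
      * (((Real.cos (u / 4) * Real.cos (u / 2))⁻¹ : ℝ) : ℂ)) (by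
    intro u hu
    obtain ⟨h1, h2⟩ := hc u hu
    have h3 : ContDiffAt ℝ 1 (fun u : ℝ => (Real.cos (u / 4) * Real.cos (u / 2))⁻¹) u :=
      ContDiffAt.inv (by fun_prop) (mul_pos h1 h2).ne'
    have h4 : ContDiffAt ℝ 1 (fun u : ℝ => μ * u + u / 4) u := by fun_prop
    have h5 := Complex.ofRealCLM.contDiff.contDiffAt.comp u h3
    have h6 := Complex.ofRealCLM.contDiff.contDiffAt.comp u h4
    exact ((contDiffAt_const.mul h6).neg.cexp.mul contDiffAt_const).mul h5)
  refine ⟨C, fun t ht => ?_⟩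
  refine le_of_eq_of_le (congrArg norm ?_) (hC t ht)
  rw [oscInt, oscInt, ← intervalIntegral.integral_sub]
  · refine intervalIntegral.integral_congr fun u hu => ?_
    obtain ⟨h1, h2⟩ := hc u hu
    have h1' : (Real.cos (u / 4) : ℂ) ≠ 0 := Complex.ofReal_ne_zero.2 h1.ne'
    have h2' : (Real.cos (u / 2) : ℂ) ≠ 0 := Complex.ofReal_ne_zero.2 h2.ne'
    have hs : Real.sin u = 4 * Real.sin (u / 4) * Real.cos (u / 4) * Real.cos (u / 2) := by
      have a1 : Real.sin u = 2 * Real.sin (u / 2) * Real.cos (u / 2) := by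
        rw [← Real.sin_two_mul]; congr 1; ring
      have a2 : Real.sin (u / 2) = 2 * Real.sin (u / 4) * Real.cos (u / 4) := by
        rw [← Real.sin_two_mul]; congr 1; ring
      rw [a1, a2]; ring
    have e1 : Complex.I * ((t * Real.cos u - (μ + 1 / 2) * u : ℝ) : ℂ)
        = -(Complex.I * ((μ * u + u / 4 : ℝ) : ℂ)) + Complex.I * ((t * Real.cos u : ℝ) : ℂ)
          + ((-(u / 4) : ℝ) : ℂ) * Complex.I := by push_cast; ring
    have e2 : Complex.I * ((t * Real.cos u - μ * u : ℝ) : ℂ)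
        = -(Complex.I * ((μ * u + u / 4 : ℝ) : ℂ)) + Complex.I * ((t * Real.cos u : ℝ) : ℂ)
          + ((u / 4 : ℝ) : ℂ) * Complex.I := by push_cast; ring
    rw [e1, e2, Complex.exp_add, Complex.exp_add, Complex.exp_add, Complex.exp_add,
      Complex.exp_mul_I, Complex.exp_mul_I, ← Complex.ofReal_cos, ← Complex.ofReal_sin, ← Complex.ofReal_cos,
      ← Complex.ofReal_sin, Real.cos_neg, Real.sin_neg, hs]
    generalize Complex.exp (-(Complex.I * ((μ * u + u / 4 : ℝ) : ℂ))) = E1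
    generalize Complex.exp (Complex.I * ((t * Real.cos u : ℝ) : ℂ)) = E2
    push_cast at h1' h2' ⊢
    field_simp
    ring
  · exact (by fun_prop : Continuous _).intervalIntegrable _ _
  · exact (by fun_prop : Continuous _).intervalIntegrable _ _

/-! ### The Fresnel integral -/

/-- Integration by parts against `-1/(2by)`. The bound does not degrade as `Re b → 0`, which is what
allows passage to the Fresnel integral. -/
theorem norm_integral_gaussian_tail_le {b : ℂ} (hb : 0 ≤ b.re) (hb0 : b ≠ 0) {T S : ℝ}
    (hT : 0 < T) (hTS : T ≤ S) :
    ‖∫ y in T..S, Complex.exp (-b * (y : ℂ) ^ 2)‖ ≤ 1 / (‖b‖ * T) := by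
  have hpos : ∀ y ∈ Set.uIcc T S, 0 < y := fun y hy => by
    rw [Set.uIcc_of_le hTS] at hy; exact hT.trans_le hy.1
  have hbn : 0 < ‖b‖ := norm_pos_iff.2 hb0
  have hn : ∀ y : ℝ, ‖Complex.exp (-b * (y : ℂ) ^ 2)‖ ≤ 1 := fun y => by
    rw [Complex.norm_exp, Real.exp_le_one_iff, ← Complex.ofReal_pow, Complex.re_mul_ofReal,
      Complex.neg_re]
    nlinarith [mul_nonneg hb (sq_nonneg y)]
  have hv : ∀ y : ℝ, HasDerivAt (fun y : ℝ => Complex.exp (-b * (y : ℂ) ^ 2))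
      (Complex.exp (-b * (y : ℂ) ^ 2) * (-b * ((2 * y : ℝ) : ℂ))) y := fun y => by
    have := ((hasDerivAt_pow 2 y).ofReal_comp.const_mul (-b)).cexp
    simpa using this
  have hu : ∀ y ∈ Set.uIcc T S, HasDerivAt (fun y : ℝ => -(2 * b)⁻¹ * ((y⁻¹ : ℝ) : ℂ))
      (-(2 * b)⁻¹ * ((-(y ^ 2)⁻¹ : ℝ) : ℂ)) y := fun y hy =>
    (hasDerivAt_inv (hpos y hy).ne').ofReal_comp.const_mul _
  have hci : ContinuousOn (fun y : ℝ => (y ^ 2)⁻¹) (Set.uIcc T S) :=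
    ContinuousOn.inv₀ (by fun_prop) fun y hy => (pow_pos (hpos y hy) 2).ne'
  have hcu : ContinuousOn (fun y : ℝ => -(2 * b)⁻¹ * ((-(y ^ 2)⁻¹ : ℝ) : ℂ)) (Set.uIcc T S) :=
    continuousOn_const.mul (Complex.continuous_ofReal.comp_continuousOn hci.neg)
  have key := intervalIntegral.integral_mul_deriv_eq_deriv_mul (a := T) (b := S)
    hu (fun y _ => hv y) hcu.intervalIntegrable
    ((by fun_prop : Continuous _).intervalIntegrable _ _)
  have e : ∫ y in T..S, -(2 * b)⁻¹ * ((y⁻¹ : ℝ) : ℂ)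
        * (Complex.exp (-b * (y : ℂ) ^ 2) * (-b * ((2 * y : ℝ) : ℂ)))
      = ∫ y in T..S, Complex.exp (-b * (y : ℂ) ^ 2) := by
    refine intervalIntegral.integral_congr fun y hy => ?_
    have : (y : ℂ) ≠ 0 := Complex.ofReal_ne_zero.2 (hpos y hy).ne'
    push_cast
    field_simp
  rw [e] at key
  have hnorm : ‖-(2 * b)⁻¹‖ = (2 * ‖b‖)⁻¹ := by
    rw [norm_neg, norm_inv, norm_mul, Complex.norm_ofNat]
  have hi : ∫ y in T..S, (2 * ‖b‖)⁻¹ * (y ^ 2)⁻¹ = (2 * ‖b‖)⁻¹ * (T⁻¹ - S⁻¹) := by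
    have := intervalIntegral.integral_eq_sub_of_hasDerivAt (a := T) (b := S)
      (f := fun y : ℝ => (2 * ‖b‖)⁻¹ * -y⁻¹) (f' := fun y => (2 * ‖b‖)⁻¹ * (y ^ 2)⁻¹)
      (fun y hy => by
        simpa using ((hasDerivAt_inv (hpos y hy).ne').fun_neg).const_mul (2 * ‖b‖)⁻¹)
      (continuousOn_const.mul hci).intervalIntegrable
    rw [this]; ring
  have h3 : ‖∫ y in T..S, -(2 * b)⁻¹ * ((-(y ^ 2)⁻¹ : ℝ) : ℂ) * Complex.exp (-b * (y : ℂ) ^ 2)‖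
      ≤ (2 * ‖b‖)⁻¹ * (T⁻¹ - S⁻¹) := by
    rw [← hi]
    refine intervalIntegral.norm_integral_le_of_norm_le hTS
      (MeasureTheory.ae_of_all _ fun y _ => ?_) (continuousOn_const.mul hci).intervalIntegrable
    rw [norm_mul, norm_mul, hnorm, Complex.norm_real, norm_neg, Real.norm_of_nonneg (by positivity)]
    exact mul_le_of_le_one_right (by positivity) (hn y)
  have hb1 : ∀ y : ℝ, 0 < y →
      ‖-(2 * b)⁻¹ * ((y⁻¹ : ℝ) : ℂ) * Complex.exp (-b * (y : ℂ) ^ 2)‖ ≤ (2 * ‖b‖)⁻¹ * y⁻¹ := by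
    intro y hy
    rw [norm_mul, norm_mul, hnorm, Complex.norm_real, Real.norm_of_nonneg (by positivity)]
    exact mul_le_of_le_one_right (by positivity) (hn y)
  -- The boundary terms give `(1/S + 1/T) / (2‖b‖)` and the remaining integral `(1/T - 1/S) /
  -- (2‖b‖)`; the `1/S` terms cancel.
  rw [key]
  refine (norm_sub_le _ _).trans ((add_le_add ((norm_sub_le _ _).trans
    (add_le_add (hb1 S (hT.trans_le hTS)) (hb1 T hT))) h3).trans (le_of_eq ?_))
  field_simp
  ring

theorem norm_integral_gaussian_sub_le {b : ℂ} (hb : 0 < b.re) {T : ℝ} (hT : 0 < T) :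
    ‖(Real.pi / b) ^ (1 / 2 : ℂ) / 2 - ∫ y in (0 : ℝ)..T, Complex.exp (-b * (y : ℂ) ^ 2)‖
      ≤ 1 / (‖b‖ * T) := by
  have hb0 : b ≠ 0 := by rintro rfl; simp at hb
  rw [← integral_gaussian_complex_Ioi hb]
  have hlim := MeasureTheory.intervalIntegral_tendsto_integral_Ioi 0
    (integrable_cexp_neg_mul_sq hb).integrableOn tendsto_id
  refine le_of_tendsto (hlim.sub_const _).norm ?_
  filter_upwards [eventually_ge_atTop T] with S hS
  have hc : Continuous fun y : ℝ => Complex.exp (-b * (y : ℂ) ^ 2) := by fun_prop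
  rw [intervalIntegral.integral_interval_sub_left (hc.intervalIntegrable _ _)
    (hc.intervalIntegrable _ _)]
  exact norm_integral_gaussian_tail_le hb.le hb0 hT hS

/-- The value of the Fresnel integral `∫_{-∞}^∞ exp (-i y² / 2) dy`. -/
noncomputable def fresnelConst : ℂ := (Real.pi / (Complex.I / 2)) ^ (1 / 2 : ℂ)

theorem fresnelConst_ne_zero : fresnelConst ≠ 0 := by
  rw [fresnelConst, Ne, Complex.cpow_eq_zero_iff]
  simp [Real.pi_ne_zero]

/-- Limit of the Gaussian estimate along `b = ε + i/2`, `ε → 0⁺`; there `‖b‖ ≥ 1/2`, whence the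
constant `2`. -/
theorem norm_fresnel_sub_le {T : ℝ} (hT : 0 < T) :
    ‖fresnelConst / 2 - ∫ y in (0 : ℝ)..T, Complex.exp (-(Complex.I / 2) * (y : ℂ) ^ 2)‖
      ≤ 2 / T := by
  have hB : Tendsto (fun ε : ℝ => (ε : ℂ) + Complex.I / 2) (𝓝[>] 0) (𝓝 (Complex.I / 2)) := by
    have : Continuous fun ε : ℝ => (ε : ℂ) + Complex.I / 2 := by fun_prop
    simpa using (this.tendsto 0).mono_left nhdsWithin_le_nhds
  have h1 : Tendsto (fun b : ℂ => (Real.pi / b) ^ (1 / 2 : ℂ) / 2) (𝓝 (Complex.I / 2))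
      (𝓝 (fresnelConst / 2)) := by
    refine ((ContinuousAt.cpow (ContinuousAt.div continuousAt_const continuousAt_id ?_)
      continuousAt_const ?_).div_const 2)
    · simp
    -- `π / (i/2)` is off the branch cut of the square root because its imaginary part is nonzero.
    · right
      simp [Complex.div_im, Real.pi_ne_zero]
  have h2 : Continuous fun b : ℂ => ∫ y in (0 : ℝ)..T, Complex.exp (-b * (y : ℂ) ^ 2) :=
    intervalIntegral.continuous_parametric_intervalIntegral_of_continuous' (by fun_prop) 0 T
  refine le_of_tendsto (((h1.sub (h2.tendsto _)).comp hB).norm) ?_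
  filter_upwards [self_mem_nhdsWithin] with ε hε
  have hre : ((ε : ℂ) + Complex.I / 2).re = ε := by simp
  have him : ((ε : ℂ) + Complex.I / 2).im = 1 / 2 := by simp
  have hnb : 1 / 2 ≤ ‖(ε : ℂ) + Complex.I / 2‖ := by
    have := Complex.abs_im_le_norm ((ε : ℂ) + Complex.I / 2)
    rw [him, abs_of_pos (by norm_num)] at this
    exact this
  refine (norm_integral_gaussian_sub_le (by rw [hre]; exact hε) hT).trans ?_
  rw [div_le_div_iff₀ (by positivity) hT]
  nlinarith

theorem tendsto_fresnel :
    Tendsto (fun T : ℝ => ∫ y in -T..T, Complex.exp (-(Complex.I / 2) * (y : ℂ) ^ 2)) atTop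
      (𝓝 fresnelConst) := by
  have h0 : Tendsto (fun T : ℝ => ∫ y in (0 : ℝ)..T, Complex.exp (-(Complex.I / 2) * (y : ℂ) ^ 2))
      atTop (𝓝 (fresnelConst / 2)) := by
    rw [tendsto_iff_norm_sub_tendsto_zero]
    refine squeeze_zero' (Eventually.of_forall fun _ => norm_nonneg _) ?_
      ((tendsto_const_nhds (x := (2 : ℝ))).div_atTop tendsto_id)
    filter_upwards [eventually_gt_atTop 0] with T hT
    rw [norm_sub_rev]
    exact norm_fresnel_sub_le hT
  have h1 := h0.add h0
  rw [add_halves] at h1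
  refine h1.congr fun T => ?_
  have hc : Continuous fun y : ℝ => Complex.exp (-(Complex.I / 2) * (y : ℂ) ^ 2) := by fun_prop
  rw [← intervalIntegral.integral_add_adjacent_intervals (hc.intervalIntegrable (-T) 0)
    (hc.intervalIntegrable 0 T)]
  congr 1
  have := intervalIntegral.integral_comp_neg (a := 0) (b := T)
    (fun y : ℝ => Complex.exp (-(Complex.I / 2) * (y : ℂ) ^ 2))
  rw [neg_zero] at this
  rw [← this]
  refine intervalIntegral.integral_congr fun y _ => ?_
  simp

/-! ### Asymptotics of the Hankel functions -/

/-- The normalization `√t exp (-it)` that removes the leading behaviour of outgoing waves. -/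
noncomputable def waveScale (t : ℝ) : ℂ := (Real.sqrt t : ℂ) * Complex.exp (-(Complex.I * t))

theorem norm_waveScale (t : ℝ) : ‖waveScale t‖ = Real.sqrt t := by
  rw [waveScale, norm_mul, Complex.norm_real, Real.norm_of_nonneg (Real.sqrt_nonneg t),
    ← mul_neg, ← Complex.ofReal_neg, mul_comm Complex.I, Complex.norm_exp_ofReal_mul_I, mul_one]

theorem tendsto_waveScale_mul_zero {f : ℝ → ℂ} {C : ℝ}
    (hf : ∀ᶠ t : ℝ in atTop, ‖f t‖ ≤ C / t) :
    Tendsto (fun t => waveScale t * f t) atTop (𝓝 0) := by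
  rw [tendsto_zero_iff_norm_tendsto_zero]
  refine squeeze_zero' (Eventually.of_forall fun _ => norm_nonneg _) ?_
    ((tendsto_const_nhds (x := C)).div_atTop Real.tendsto_sqrt_atTop)
  filter_upwards [hf, eventually_gt_atTop 0] with t ht h0
  rw [norm_mul, norm_waveScale]
  have hs := Real.sqrt_pos.2 h0
  calc _ ≤ Real.sqrt t * (C / t) := mul_le_mul_of_nonneg_left ht hs.le
    _ = C / Real.sqrt t := by
      conv_lhs => rw [← Real.mul_self_sqrt h0.le]
      rw [Real.sqrt_mul_self hs.le]
      field_simp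

/-- Averaging the orders `±1/2` gives the amplitude `cos (u/2)`, precisely the Jacobian that makes
`y = 2 √t sin (u/2)` an exact substitution: `√t cos (u/2) du = dy` and `t cos u - t = -y²/2`. The
result is a Fresnel integral over `±2 √t sin (π/4)`, with no error term. -/
theorem tendsto_oscInt_half :
    Tendsto (fun t => waveScale t * ((oscInt (1 / 2) t + oscInt (-(1 / 2)) t) / 2)) atTop
      (𝓝 fresnelConst) := by
  have hT : Tendsto (fun t : ℝ => 2 * Real.sqrt t * Real.sin (Real.pi / 4)) atTop atTop :=
    (Real.tendsto_sqrt_atTop.const_mul_atTop two_pos).atTop_mul_const (by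
      rw [Real.sin_pi_div_four]; positivity)
  refine (tendsto_fresnel.comp hT).congr' ?_
  filter_upwards [eventually_gt_atTop 0] with t ht
  have hsub := intervalIntegral.integral_deriv_smul_comp
    (a := -(Real.pi / 2)) (b := Real.pi / 2)
    (f := fun u : ℝ => 2 * Real.sqrt t * Real.sin (u / 2))
    (f' := fun u : ℝ => Real.sqrt t * Real.cos (u / 2))
    (g := fun y : ℝ => Complex.exp (-(Complex.I / 2) * (y : ℂ) ^ 2))
    (fun u _ => by
      refine ((((hasDerivAt_id u).div_const 2).sin).const_mul (2 * Real.sqrt t)).congr_deriv ?_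
      simp only [id]
      ring)
    (by fun_prop) (by fun_prop)
  rw [show -(Real.pi / 2) / 2 = -(Real.pi / 4) by ring,
    show Real.pi / 2 / 2 = Real.pi / 4 by ring, Real.sin_neg, mul_neg] at hsub
  rw [Function.comp_apply, ← hsub, oscInt, oscInt, ← intervalIntegral.integral_add,
    ← intervalIntegral.integral_div, ← intervalIntegral.integral_const_mul]
  · refine intervalIntegral.integral_congr fun u _ => ?_
    have e1 : Complex.I * ((t * Real.cos u - 1 / 2 * u : ℝ) : ℂ)
        = Complex.I * ((t * Real.cos u : ℝ) : ℂ) + ((-(u / 2) : ℝ) : ℂ) * Complex.I := by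
      push_cast; ring
    have e2 : Complex.I * ((t * Real.cos u - -(1 / 2) * u : ℝ) : ℂ)
        = Complex.I * ((t * Real.cos u : ℝ) : ℂ) + ((u / 2 : ℝ) : ℂ) * Complex.I := by
      push_cast; ring
    have e3 : -(Complex.I / 2) * ((2 * Real.sqrt t * Real.sin (u / 2) : ℝ) : ℂ) ^ 2
        = -(Complex.I * t) + Complex.I * ((t * Real.cos u : ℝ) : ℂ) := by
      have : (2 * Real.sqrt t * Real.sin (u / 2)) ^ 2 = 2 * (t - t * Real.cos u) := by
        have hc : Real.cos u = 1 - 2 * Real.sin (u / 2) ^ 2 := by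
          have := Real.cos_sq_add_sin_sq (u / 2)
          have h2 := Real.cos_two_mul (u / 2)
          rw [mul_div_cancel₀ u two_ne_zero] at h2
          linarith
        rw [mul_pow, mul_pow, Real.sq_sqrt ht.le, hc]
        ring
      rw [← Complex.ofReal_pow, this]
      push_cast
      ring
    rw [e1, e2, Function.comp_apply, e3, waveScale, Complex.exp_add, Complex.exp_add,
      Complex.exp_add, Complex.exp_mul_I, Complex.exp_mul_I, ← Complex.ofReal_cos,
      ← Complex.ofReal_sin, ← Complex.ofReal_cos, ← Complex.ofReal_sin, Real.cos_neg,
      Real.sin_neg, Complex.real_smul]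
    push_cast
    ring
  · exact (by fun_prop : Continuous _).intervalIntegrable _ _
  · exact (by fun_prop : Continuous _).intervalIntegrable _ _

theorem tendsto_oscInt_sub (μ : ℝ) :
    Tendsto (fun t => waveScale t * (oscInt (μ + 1 / 2) t - oscInt μ t)) atTop (𝓝 0) := by
  obtain ⟨C, hC⟩ := exists_norm_oscInt_sub_le μ
  exact tendsto_waveScale_mul_zero ((eventually_gt_atTop 0).mono hC)

/-- Half-steps in the order are negligible at scale `√t`, so the limit found for the average at
`±1/2` passes to order `0`, and by pairs of half-steps to every integer. -/
theorem tendsto_oscInt_int (n : ℤ) :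
    Tendsto (fun t => waveScale t * oscInt n t) atTop (𝓝 fresnelConst) := by
  have h0 : Tendsto (fun t => waveScale t * oscInt 0 t) atTop (𝓝 fresnelConst) := by
    have a1 := tendsto_oscInt_sub 0
    have a2 := tendsto_oscInt_sub (-(1 / 2))
    rw [neg_add_cancel] at a2
    rw [zero_add] at a1
    have := (tendsto_oscInt_half.sub (a1.div_const 2)).add (a2.div_const 2)
    simp only [zero_div, sub_zero, add_zero] at this
    exact this.congr fun t => by ring
  have step : ∀ μ : ℝ, Tendsto (fun t => waveScale t * (oscInt (μ + 1) t - oscInt μ t)) atTop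
      (𝓝 0) := fun μ => by
    have := (tendsto_oscInt_sub (μ + 1 / 2)).add (tendsto_oscInt_sub μ)
    rw [add_assoc, add_halves, add_zero] at this
    exact this.congr fun t => by ring
  induction n using Int.induction_on with
  | zero => simpa using h0
  | succ k ih =>
    have := ih.add (step ((k : ℤ) : ℝ))
    rw [add_zero] at this
    refine this.congr fun t => ?_
    push_cast
    ring
  | pred k ih =>
    have := ih.sub (step ((-(k : ℤ) - 1 : ℤ) : ℝ))
    rw [sub_zero] at this
    refine this.congr fun t => ?_
    push_cast
    rw [sub_add_cancel]
    ring

/-- The limit of `√t exp (-it) H^{(1)}_n(t)` as `t → ∞`. -/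
noncomputable def hankelLim (n : ℤ) : ℂ :=
  (1 / Real.pi : ℝ) * (Complex.exp (-(Complex.I * (n * (Real.pi / 2)))) * fresnelConst)

theorem hankelLim_ne_zero (n : ℤ) : hankelLim n ≠ 0 := by
  rw [hankelLim]
  refine mul_ne_zero ?_ (mul_ne_zero (Complex.exp_ne_zero _) fresnelConst_ne_zero)
  exact Complex.ofReal_ne_zero.2 (by positivity)

theorem tendsto_hankel1 (n : ℤ) :
    Tendsto (fun t => waveScale t * hankel1 n t) atTop (𝓝 (hankelLim n)) := by
  have h1 : Tendsto (fun t => waveScale t * hankelOsc n t) atTop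
      (𝓝 (Complex.exp (-(Complex.I * (n * (Real.pi / 2)))) * fresnelConst)) := by
    refine ((tendsto_oscInt_int n).const_mul _).congr fun t => ?_
    rw [hankelOsc_eq]; ring
  have h2 : Tendsto (fun t => waveScale t * (hankelDecay n t : ℂ)) atTop (𝓝 0) := by
    -- For `t > 2|n|` one has `t - |n| > t/2`, so `2 / (t - |n|) ≤ 4/t`.
    refine tendsto_waveScale_mul_zero (C := 4) ?_
    filter_upwards [eventually_gt_atTop (2 * |(n : ℝ)|), eventually_gt_atTop 0] with t ht h0
    have hn := abs_nonneg (n : ℝ)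
    rw [Complex.norm_real, Real.norm_eq_abs]
    refine (abs_hankelDecay_le n (by linarith)).trans ?_
    rw [div_le_div_iff₀ (by linarith) h0]
    linarith
  have := (h1.const_mul ((1 / Real.pi : ℝ) : ℂ)).sub
    (h2.const_mul (Complex.I * ((1 / Real.pi : ℝ) : ℂ)))
  rw [mul_zero, sub_zero] at this
  refine this.congr fun t => ?_
  rw [hankel1_eq]; ring

/-- The recurrence avoids differentiating an asymptotic relation: the limits at `n - 1` and `n + 1`
are `i` and `-i` times the limit at `n`. -/
theorem tendsto_deriv_hankel1 (n : ℤ) :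
    Tendsto (fun t => waveScale t * deriv (hankel1 n) t) atTop (𝓝 (Complex.I * hankelLim n)) := by
  have h := ((tendsto_hankel1 (n - 1)).sub (tendsto_hankel1 (n + 1))).div_const 2
  have e : (hankelLim (n - 1) - hankelLim (n + 1)) / 2 = Complex.I * hankelLim n := by
    have e1 : -(Complex.I * (((n - 1 : ℤ) : ℂ) * (Real.pi / 2)))
        = -(Complex.I * (n * (Real.pi / 2))) + Real.pi / 2 * Complex.I := by push_cast; ring
    have e2 : -(Complex.I * (((n + 1 : ℤ) : ℂ) * (Real.pi / 2)))
        = -(Complex.I * (n * (Real.pi / 2))) + -(Real.pi / 2 * Complex.I) := by push_cast; ring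
    rw [hankelLim, hankelLim, hankelLim, e1, e2, Complex.exp_add, Complex.exp_add,
      Complex.exp_neg (Real.pi / 2 * Complex.I), Complex.exp_pi_div_two_mul_I, Complex.inv_I]
    ring
  rw [e] at h
  refine h.congr' ?_
  filter_upwards [eventually_gt_atTop (|(n : ℝ)| + 2)] with t ht
  rw [(hasDerivAt_hankel1 n ht).deriv]
  ring

/-! ### Differentiating outgoing waves on a circle -/

theorem hasFDerivAt_norm_of_ne_zero {x : Plane} (hx : x ≠ 0) :
    HasFDerivAt (fun y : Plane => ‖y‖) (‖x‖⁻¹ • innerSL ℝ x) x := by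
  have h := (hasStrictFDerivAt_norm_sq x).hasFDerivAt.sqrt (by simpa using hx)
  simp only [Real.sqrt_sq (norm_nonneg _)] at h
  refine h.congr_fderiv ?_
  ext v
  simp only [_root_.smul_apply, smul_eq_mul, nsmul_eq_mul]
  have := norm_ne_zero_iff.2 hx
  field_simp
  norm_num

theorem norm_polar {R : ℝ} (hR : 0 ≤ R) (φ : ℝ) :
    ‖(!₂[R * Real.cos φ, R * Real.sin φ] : Plane)‖ = R := by
  rw [EuclideanSpace.norm_eq]
  simp only [Fin.sum_univ_two, Real.norm_eq_abs, sq_abs]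
  rw [Real.sqrt_eq_iff_mul_self_eq (by positivity) hR]
  simp
  linear_combination R ^ 2 * Real.cos_sq_add_sin_sq φ

/-- The derivative of an outgoing wave in polar coordinates. -/
theorem fderiv_outgoing (m : ℤ) {κ R : ℝ} (hR : 0 < R) (φ : ℝ)
    (hH : DifferentiableAt ℝ (hankel1 m) (κ * R)) (v : Plane) :
    fderiv ℝ (outgoing m κ) (!₂[R * Real.cos φ, R * Real.sin φ] : Plane) v
      = Complex.exp (Complex.I * (m * φ)) *
        (κ * deriv (hankel1 m) (κ * R) * (v 0 * Real.cos φ + v 1 * Real.sin φ)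
          + Complex.I * m / R * hankel1 m (κ * R) * (v 1 * Real.cos φ - v 0 * Real.sin φ)) := by
  set x : Plane := !₂[R * Real.cos φ, R * Real.sin φ] with hx
  have hxn : ‖x‖ = R := norm_polar hR.le φ
  have hx0 : x ≠ 0 := by rw [← norm_pos_iff, hxn]; exact hR
  have hRC : (R : ℂ) ≠ 0 := Complex.ofReal_ne_zero.2 hR.ne'
  have hρ := hasFDerivAt_norm_of_ne_zero hx0
  have hH' : HasDerivAt (hankel1 m) (deriv (hankel1 m) (κ * R)) (κ * ‖x‖) := by
    rw [hxn]; exact hH.hasDerivAt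
  have h1 : HasFDerivAt (fun y : Plane => hankel1 m (κ * ‖y‖)) _ x :=
    HasFDerivAt.comp (g := hankel1 m) x hH'.hasFDerivAt (hρ.const_mul κ)
  -- The coordinate `x₁ + i x₂` as a real-linear map, so that `e^{iφ}` becomes `‖y‖⁻¹ • W y`.
  let W : Plane →L[ℝ] ℂ := Complex.ofRealCLM.comp (EuclideanSpace.proj 0)
    + Complex.I • Complex.ofRealCLM.comp (EuclideanSpace.proj 1)
  have hW : ∀ y : Plane, W y = (y 0 : ℂ) + Complex.I * (y 1 : ℂ) := fun y => by simp [W]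
  have hi : HasFDerivAt (fun y : Plane => ‖y‖⁻¹) _ x :=
    HasDerivAt.comp_hasFDerivAt x (hasDerivAt_inv (norm_ne_zero_iff.2 hx0)) hρ
  have h2 : HasFDerivAt (fun y : Plane => ‖y‖⁻¹ • W y) _ x := hi.smul W.hasFDerivAt
  have hu : ‖x‖⁻¹ • W x = Complex.exp (Complex.I * φ) := by
    rw [hW, hxn, mul_comm Complex.I (φ : ℂ), Complex.exp_mul_I, hx, Complex.real_smul]
    simp
    field_simp
  have hz : HasDerivAt (fun z : ℂ => z ^ m)
      (m * Complex.exp (Complex.I * φ) ^ (m - 1)) (‖x‖⁻¹ • W x) := by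
    rw [hu]; exact hasDerivAt_zpow m _ (Or.inl (Complex.exp_ne_zero _))
  have h3 : HasFDerivAt (fun y : Plane => (‖y‖⁻¹ • W y) ^ m) _ x :=
    HasFDerivAt.comp (g := fun z : ℂ => z ^ m) x (hz.hasFDerivAt.restrictScalars ℝ) h2
  have h5 := HasFDerivAt.fun_mul h1 h3
  have hf : outgoing m κ = fun y : Plane => hankel1 m (κ * ‖y‖) * (‖y‖⁻¹ • W y) ^ m := by
    funext y
    rw [outgoing, hW, Complex.real_smul, Complex.ofReal_inv, div_eq_inv_mul]
  rw [hf, h5.fderiv]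
  have hm : Complex.exp (Complex.I * (m * φ)) = Complex.exp (Complex.I * φ) ^ m := by
    rw [← Complex.exp_int_mul]; congr 1; ring
  have hv : inner ℝ x v = R * (v 0 * Real.cos φ + v 1 * Real.sin φ) := by
    simp [hx, PiLp.inner_apply, Fin.sum_univ_two]
    ring
  have hs : (Real.cos φ : ℂ) ^ 2 + (Real.sin φ : ℂ) ^ 2 = 1 := by
    exact_mod_cast Real.cos_sq_add_sin_sq φ
  have hE0 : Complex.exp (Complex.I * φ) ≠ 0 := Complex.exp_ne_zero _
  have hE : Complex.exp (Complex.I * φ) = Real.cos φ + Complex.I * Real.sin φ := by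
    rw [mul_comm, Complex.exp_mul_I, Complex.ofReal_cos, Complex.ofReal_sin]; ring
  have hWx : W x = R * Complex.exp (Complex.I * φ) := by
    rw [← hu, Complex.real_smul, hxn]
    push_cast
    field_simp
  have hzp : Complex.exp (Complex.I * φ) ^ (m - 1) * Complex.exp (Complex.I * φ)
      = Complex.exp (Complex.I * φ) ^ m := by
    rw [← zpow_add_one₀ hE0, sub_add_cancel]
  rw [hu, hm]
  -- The derivative of `e^{iφ}` along `v`: the radial part of `v` cancels and only its tangential
  -- part remains.
  have hang : (R : ℂ)⁻¹ * W v + -((R : ℂ) ^ 2)⁻¹ * ((R : ℂ)⁻¹ * (R * (v 0 * Real.cos φ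
      + v 1 * Real.sin φ))) * W x = Complex.exp (Complex.I * φ)
        * (Complex.I / R * (v 1 * Real.cos φ - v 0 * Real.sin φ)) := by
    rw [hWx, hW, hE]
    field_simp
    linear_combination (-(v 0 : ℂ) - Complex.I * v 1) * hs
      + (- v 1 * Real.cos φ * Real.sin φ + v 0 * Real.sin φ ^ 2) * Complex.I_sq
  simp only [hxn, add_apply, _root_.smul_apply, ContinuousLinearMap.comp_apply]
  simp [hv]
  have hinv : (R : ℂ)⁻¹ * R = 1 := inv_mul_cancel₀ hRC
  rw [Complex.ofReal_cos, Complex.ofReal_sin] at hang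
  linear_combination
    (hankel1 m (κ * R) * m * Complex.exp (Complex.I * φ) ^ (m - 1)) * hang
    + (hankel1 m (κ * R) * m * (Complex.I / R * (v 1 * Complex.cos φ - v 0 * Complex.sin φ))) * hzp
    + (Complex.exp (Complex.I * φ) ^ m * κ * deriv (hankel1 m) (κ * R)
      * (v 0 * Complex.cos φ + v 1 * Complex.sin φ)) * hinv

/-- The radial coefficient of the exterior field on the circle of radius `R`. -/
noncomputable def radCoeff (B : Background) (R : ℝ) : WaveMode → ℤ → ℂ
  | WaveMode.P, m => gP B R m
  | WaveMode.S, m => Complex.I * m / R * hankel1 m (B.kappa WaveMode.S * R)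

/-- The tangential coefficient of the exterior field on the circle of radius `R`. -/
noncomputable def tanCoeff (B : Background) (R : ℝ) : WaveMode → ℤ → ℂ
  | WaveMode.P, m => Complex.I * m / R * hankel1 m (B.kappa WaveMode.P * R)
  | WaveMode.S, m => hS B R m

/-- In the polar frame the gradient is `(∂_r, R⁻¹ ∂_φ)` and the curl is `(R⁻¹ ∂_φ, -∂_r)`. The large
`∂_r` term is therefore radial for P and tangential for S. -/
theorem extField_circlePoint (B : Background) {R : ℝ} (hR : 0 < R) (α : WaveMode) (m : ℤ)
    (hH : DifferentiableAt ℝ (hankel1 m) (B.kappa α * R)) (N : ℕ) (j : Fin N) :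
    extField B α m (circlePoint N R j) =
      ![Complex.exp (Complex.I * (m * gridAngle N j)) * (radCoeff B R α m * Real.cos (gridAngle N j)
          - tanCoeff B R α m * Real.sin (gridAngle N j)),
        Complex.exp (Complex.I * (m * gridAngle N j)) * (radCoeff B R α m * Real.sin (gridAngle N j)
          + tanCoeff B R α m * Real.cos (gridAngle N j))] := by
  have h0 := fderiv_outgoing m hR (gridAngle N j) hH (EuclideanSpace.single 0 1)
  have h1 := fderiv_outgoing m hR (gridAngle N j) hH (EuclideanSpace.single 1 1)
  cases α
  · funext i
    fin_cases i
    · refine h0.trans ?_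
      simp [radCoeff, tanCoeff, gP]
      ring
    · refine h1.trans ?_
      simp [radCoeff, tanCoeff, gP]
  · funext i
    fin_cases i
    · refine h1.trans ?_
      simp [radCoeff, tanCoeff, hS]
      ring
    · refine (congrArg Neg.neg h0).trans ?_
      simp [radCoeff, tanCoeff, hS]
      ring

/-! ### Gram matrices -/

/-- A geometric sum over powers of an `N`-th root of unity, which differs from `1` because `N`
cannot divide `k ≠ 0` with `|k| < N`. -/
theorem sum_exp_gridAngle {N : ℕ} {k : ℤ} (hk : |k| < N) :
    ∑ j : Fin N, Complex.exp (Complex.I * (k * gridAngle N j)) = if k = 0 then (N : ℂ) else 0 := by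
  split_ifs with h0
  · simp [h0]
  have hN : (N : ℂ) ≠ 0 := by
    rintro h
    rw [Nat.cast_eq_zero] at h
    have := abs_nonneg k
    omega
  set z : ℂ := Complex.exp (2 * Real.pi * Complex.I * (k / N)) with hz
  -- The extra factor `z` appears because grid angles are counted from `1`.
  have e : ∀ j : Fin N, Complex.exp (Complex.I * (k * gridAngle N j)) = z * z ^ (j : ℕ) := by
    intro j
    rw [← pow_succ', hz, ← Complex.exp_nat_mul, gridAngle]
    congr 1
    push_cast
    ring
  have hzN : z ^ N = 1 := by
    rw [hz, ← Complex.exp_nat_mul, Complex.exp_eq_one_iff]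
    refine ⟨k, ?_⟩
    field_simp
  have hz1 : z ≠ 1 := by
    rw [hz, Ne, Complex.exp_eq_one_iff]
    rintro ⟨n, hn⟩
    have h2 : (k : ℂ) = n * N := by
      have : (2 * Real.pi * Complex.I : ℂ) ≠ 0 := Complex.two_pi_I_ne_zero
      rw [mul_comm] at hn
      have h3 := mul_right_cancel₀ this hn
      field_simp at h3
      rw [h3]; ring
    have h3 : k = n * N := by exact_mod_cast h2
    exact h0 (Int.eq_zero_of_abs_lt_dvd (m := N) ⟨n, by rw [h3, mul_comm]⟩ hk)
  rw [Finset.sum_congr rfl fun j _ => e j, ← Finset.mul_sum,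
    Fin.sum_univ_eq_sum_range (fun j => z ^ j), geom_sum_eq hz1, hzN]
  simp

theorem abs_order_sub_lt {K N : ℕ} (hN : 2 * K + 1 ≤ N) (i j : Fin (2 * K + 1)) :
    |order K i - order K j| < N := by
  have := i.2
  have := j.2
  rw [order, order, abs_lt]
  omega

theorem order_sub_eq_zero_iff {K : ℕ} (i j : Fin (2 * K + 1)) :
    order K i - order K j = 0 ↔ i = j := by
  rw [order, order, Fin.ext_iff]
  omega

theorem star_exp_mul_exp (m n : ℤ) (φ : ℝ) :
    (starRingEnd ℂ) (Complex.exp (Complex.I * (m * φ))) * Complex.exp (Complex.I * (n * φ))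
      = Complex.exp (Complex.I * ((n - m : ℤ) * φ)) := by
  rw [← Complex.exp_conj, ← Complex.exp_add]
  congr 1
  simp
  ring

/-- Parseval's identity for an orthonormal basis of the plane. -/
theorem star_conjDot_mul_add {d p : Plane} (hd : ‖d‖ = 1) (hp : ‖p‖ = 1) (h : inner ℝ d p = 0)
    (u w : Fin 2 → ℂ) :
    star (conjDot u d) * conjDot w d + star (conjDot u p) * conjDot w p
      = u 0 * (starRingEnd ℂ) (w 0) + u 1 * (starRingEnd ℂ) (w 1) := by
  have hd' : d 0 ^ 2 + d 1 ^ 2 = 1 := by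
    have := EuclideanSpace.norm_sq_eq d
    rw [hd] at this
    simpa [Fin.sum_univ_two] using this.symm
  have hp' : p 0 ^ 2 + p 1 ^ 2 = 1 := by
    have := EuclideanSpace.norm_sq_eq p
    rw [hp] at this
    simpa [Fin.sum_univ_two] using this.symm
  have h' : d 0 * p 0 + d 1 * p 1 = 0 := by
    simp only [PiLp.inner_apply, Fin.sum_univ_two] at h
    simp at h
    linarith
  have hM : !![d 0, d 1; p 0, p 1] * !![d 0, p 0; d 1, p 1] = 1 := by
    ext i j
    fin_cases i <;> fin_cases j <;> simp [Matrix.mul_apply, Fin.sum_univ_two] <;> linarith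
  -- Orthonormal rows force orthonormal columns; the column relations are the ones needed.
  have hM' := mul_eq_one_comm.1 hM
  have a00 : d 0 * d 0 + p 0 * p 0 = 1 := by
    simpa [Matrix.mul_apply, Fin.sum_univ_two] using congrFun (congrFun hM' 0) 0
  have a01 : d 0 * d 1 + p 0 * p 1 = 0 := by
    simpa [Matrix.mul_apply, Fin.sum_univ_two] using congrFun (congrFun hM' 0) 1
  have a11 : d 1 * d 1 + p 1 * p 1 = 1 := by
    simpa [Matrix.mul_apply, Fin.sum_univ_two] using congrFun (congrFun hM' 1) 1
  have b00 : (d 0 : ℂ) * d 0 + p 0 * p 0 = 1 := by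
    simpa using congrArg Complex.ofReal a00
  have b01 : (d 0 : ℂ) * d 1 + p 0 * p 1 = 0 := by
    simpa using congrArg Complex.ofReal a01
  have b11 : (d 1 : ℂ) * d 1 + p 1 * p 1 = 1 := by
    simpa using congrArg Complex.ofReal a11
  simp only [conjDot, Fin.sum_univ_two, star_add, star_mul', Complex.star_def, Complex.conj_conj,
    Complex.conj_ofReal]
  linear_combination (u 0 * (starRingEnd ℂ) (w 0)) * b00
    + (u 0 * (starRingEnd ℂ) (w 1) + u 1 * (starRingEnd ℂ) (w 0)) * b01
    + (u 1 * (starRingEnd ℂ) (w 1)) * b11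

namespace BlockIdx

/-- The wave mode of a block index. -/
def mode {K : ℕ} : BlockIdx K → WaveMode := Sum.elim (fun _ => WaveMode.P) (fun _ => WaveMode.S)

/-- The position of a block index inside its block. -/
def pos {K : ℕ} : BlockIdx K → Fin (2 * K + 1) := Sum.elim id id

end BlockIdx

/-- The diagonal coefficient `g^P_m` or `h^S_m` at a block index. -/
noncomputable def leadCoeff (B : Background) {K : ℕ} (R : ℝ) : BlockIdx K → ℂ :=
  Sum.elim (fun i => gP B R (order K i)) (fun i => hS B R (order K i))

theorem ZY_eq_diagonal (B : Background) (K : ℕ) (R : ℝ) :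
    ZY B K R = Matrix.diagonal
      fun a => leadCoeff B R a * (starRingEnd ℂ) (leadCoeff B R a) := by
  rw [ZY, Matrix.fromBlocks_diagonal]
  congr 1
  funext a
  cases a <;> rfl

/-- The radial coefficient at a block index. -/
noncomputable def radAt (B : Background) {K : ℕ} (R : ℝ) (a : BlockIdx K) : ℂ :=
  radCoeff B R (BlockIdx.mode a) (order K (BlockIdx.pos a))

/-- The tangential coefficient at a block index. -/
noncomputable def tanAt (B : Background) {K : ℕ} (R : ℝ) (a : BlockIdx K) : ℂ :=
  tanCoeff B R (BlockIdx.mode a) (order K (BlockIdx.pos a))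

/-- Parseval eliminates the receiver directions, and rotating to the polar frame preserves the
Hermitian product. Only a character depends on the receiver, so the sum decouples distinct orders,
while P and S of equal order stay coupled. -/
theorem Ymat_conjTranspose_mul_self_apply (B : Background) {K Nr : ℕ} (hNr : 2 * K + 1 ≤ Nr)
    {d dperp : Fin Nr → Plane} (hd : ∀ r, ‖d r‖ = 1) (hdperp : ∀ r, ‖dperp r‖ = 1)
    (horth : ∀ r, inner ℝ (d r) (dperp r) = 0) {R : ℝ} (hR : 0 < R)
    (hH : ∀ a : BlockIdx K, DifferentiableAt ℝ (hankel1 (order K (BlockIdx.pos a)))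
      (B.kappa (BlockIdx.mode a) * R)) (a b : BlockIdx K) :
    ((Ymat B K Nr d dperp R).conjTranspose * Ymat B K Nr d dperp R) a b =
      if BlockIdx.pos a = BlockIdx.pos b then
        Nr * (radAt B R a * (starRingEnd ℂ) (radAt B R b)
          + tanAt B R a * (starRingEnd ℂ) (tanAt B R b))
      else 0 := by
  have hl : ∀ r (a : BlockIdx K), Ymat B K Nr d dperp R (Sum.inl r) a = conjDot
      (extField B (BlockIdx.mode a) (order K (BlockIdx.pos a)) (circlePoint Nr R r)) (d r) := by
    intro r a
    cases a <;> rfl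
  have hr : ∀ r (a : BlockIdx K), Ymat B K Nr d dperp R (Sum.inr r) a = conjDot
      (extField B (BlockIdx.mode a) (order K (BlockIdx.pos a)) (circlePoint Nr R r)) (dperp r) := by
    intro r a
    cases a <;> rfl
  rw [Matrix.mul_apply, Fintype.sum_sum_type, ← Finset.sum_add_distrib]
  have key : ∀ r : Fin Nr,
      (Ymat B K Nr d dperp R).conjTranspose a (Sum.inl r) * Ymat B K Nr d dperp R (Sum.inl r) b
      + (Ymat B K Nr d dperp R).conjTranspose a (Sum.inr r) * Ymat B K Nr d dperp R (Sum.inr r) b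
      = Complex.exp (Complex.I * ((order K (BlockIdx.pos a) - order K (BlockIdx.pos b) : ℤ)
          * gridAngle Nr r)) * (radAt B R a * (starRingEnd ℂ) (radAt B R b)
          + tanAt B R a * (starRingEnd ℂ) (tanAt B R b)) := by
    intro r
    rw [Matrix.conjTranspose_apply, Matrix.conjTranspose_apply, hl, hl, hr, hr,
      star_conjDot_mul_add (hd r) (hdperp r) (horth r), extField_circlePoint B hR _ _ (hH a),
      extField_circlePoint B hR _ _ (hH b), ← star_exp_mul_exp]
    have hs : (Real.cos (gridAngle Nr r) : ℂ) ^ 2 + (Real.sin (gridAngle Nr r) : ℂ) ^ 2 = 1 := by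
      exact_mod_cast Real.cos_sq_add_sin_sq (gridAngle Nr r)
    simp only [Matrix.cons_val_zero, Matrix.cons_val_one, map_mul, map_add, map_sub,
      Complex.conj_ofReal, radAt, tanAt]
    linear_combination
      (Complex.exp (Complex.I * (order K (BlockIdx.pos a) * gridAngle Nr r))
      * (starRingEnd ℂ) (Complex.exp (Complex.I * (order K (BlockIdx.pos b) * gridAngle Nr r)))
      * (radCoeff B R (BlockIdx.mode a) (order K (BlockIdx.pos a))
          * (starRingEnd ℂ) (radCoeff B R (BlockIdx.mode b) (order K (BlockIdx.pos b)))
        + tanCoeff B R (BlockIdx.mode a) (order K (BlockIdx.pos a))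
          * (starRingEnd ℂ) (tanCoeff B R (BlockIdx.mode b) (order K (BlockIdx.pos b))))) * hs
  rw [Finset.sum_congr rfl fun r _ => key r, ← Finset.sum_mul,
    sum_exp_gridAngle (abs_order_sub_lt hNr _ _)]
  simp only [order_sub_eq_zero_iff, ite_mul, zero_mul]

/-! ### The Gram matrix of the sources -/

theorem Background.speed_pos (B : Background) (α : WaveMode) : 0 < B.speed α := by
  have := B.lam_pos
  have := B.mu_pos
  have := B.rho_pos
  cases α <;> exact Real.sqrt_pos.2 (by positivity)

theorem Background.kappa_pos (B : Background) (α : WaveMode) : 0 < B.kappa α :=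
  div_pos B.omega_pos (B.speed_pos α)

theorem Background.b_pos (B : Background) (α : WaveMode) : 0 < B.b α := by
  have := B.rho_pos
  have := B.omega_pos
  have := B.speed_pos α
  have := B.kappa_pos α
  rw [Background.b]
  positivity

theorem Background.dCoeff_eq (B : Background) (β : WaveMode) (m : ℤ) (θ : ℝ) :
    B.dCoeff β m θ
      = (B.b β : ℂ)⁻¹ * Complex.exp (Complex.I * (m * ((Real.pi / 2 - θ : ℝ) : ℂ))) := by
  have h1 : (B.rho : ℂ) ≠ 0 := Complex.ofReal_ne_zero.2 B.rho_pos.ne'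
  have h2 : (B.omega : ℂ) ≠ 0 := Complex.ofReal_ne_zero.2 B.omega_pos.ne'
  have h3 : (B.speed β : ℂ) ≠ 0 := Complex.ofReal_ne_zero.2 (B.speed_pos β).ne'
  have h4 : (B.kappa β : ℂ) ≠ 0 := Complex.ofReal_ne_zero.2 (B.kappa_pos β).ne'
  rw [Background.dCoeff, Background.planeCoeff, Background.b, mul_assoc Complex.I, ← mul_assoc]
  congr 1
  push_cast
  field_simp
  rw [Complex.I_sq]
  norm_num

/-- The shift `θ₀ - π/2` contributes a phase independent of the source, equal to `1` on the
diagonal; off it the character sum vanishes. -/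
theorem Xblock_conjTranspose_mul_self (B : Background) {K Ns : ℕ} (hNs : 2 * K + 1 ≤ Ns) (θ₀ : ℝ)
    (β : WaveMode) :
    (Xblock B K Ns θ₀ β).conjTranspose * Xblock B K Ns θ₀ β
      = (Ns : ℂ) • Matrix.diagonal fun _ => ((|B.b β| ^ 2 : ℝ) : ℂ)⁻¹ := by
  ext i j
  rw [Matrix.mul_apply]
  have key : ∀ s : Fin Ns, (Xblock B K Ns θ₀ β).conjTranspose i s * Xblock B K Ns θ₀ β s j
      = Complex.exp (Complex.I * ((order K i - order K j : ℤ) * gridAngle Ns s))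
        * (Complex.exp (Complex.I * ((order K i - order K j : ℤ) * ((θ₀ - Real.pi / 2 : ℝ) : ℂ)))
          * ((|B.b β| ^ 2 : ℝ) : ℂ)⁻¹) := by
    intro s
    rw [Matrix.conjTranspose_apply]
    simp only [Xblock, Matrix.of_apply, B.dCoeff_eq, star_mul', Complex.star_def, map_inv₀,
      Complex.conj_ofReal]
    rw [mul_mul_mul_comm, star_exp_mul_exp, sq_abs, ← mul_assoc (Complex.exp _),
      ← Complex.exp_add, mul_comm]
    congr 1
    · congr 1
      push_cast
      ring
    · push_cast
      rw [← mul_inv, sq]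
  rw [Finset.sum_congr rfl fun s _ => key s, ← Finset.sum_mul,
    sum_exp_gridAngle (abs_order_sub_lt hNs _ _), Matrix.smul_apply, Matrix.diagonal_apply]
  simp only [order_sub_eq_zero_iff]
  split_ifs with h
  · simp [h]
  · simp

theorem Xmat_conjTranspose_mul_self (B : Background) {K Ns : ℕ} (hNs : 2 * K + 1 ≤ Ns) (θ₀ : ℝ) :
    (Xmat B K Ns θ₀).conjTranspose * Xmat B K Ns θ₀ = (Ns : ℂ) • ZX B K := by
  rw [Xmat, Matrix.fromBlocks_conjTranspose, Matrix.fromBlocks_multiply, ZX,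
    Matrix.fromBlocks_smul]
  simp [Xblock_conjTranspose_mul_self B hNs]

theorem ZX_eq_diagonal (B : Background) (K : ℕ) :
    ZX B K = Matrix.diagonal fun a => ((|B.b (BlockIdx.mode a)| ^ 2 : ℝ) : ℂ)⁻¹ := by
  rw [ZX, Matrix.fromBlocks_diagonal]
  congr 1
  funext a
  cases a <;> rfl

theorem isUnit_ZX (B : Background) (K : ℕ) : IsUnit (ZX B K) := by
  rw [ZX_eq_diagonal, Matrix.isUnit_diagonal, Pi.isUnit_iff]
  intro a
  have := B.b_pos (BlockIdx.mode a)
  rw [isUnit_iff_ne_zero]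
  exact inv_ne_zero (Complex.ofReal_ne_zero.2 (by positivity))

/-! ### Limits of the coefficients -/

/-- Moduli are taken because the phases `e^{iκR}` of the two modes turn at different rates and do
not cancel in quotients. -/
theorem tendsto_sqrt_mul_norm_comp {f : ℝ → ℂ} {c : ℂ} {κ : ℝ} (hκ : 0 < κ)
    (hf : Tendsto (fun t => waveScale t * f t) atTop (𝓝 c)) :
    Tendsto (fun R => Real.sqrt R * ‖f (κ * R)‖) atTop (𝓝 (‖c‖ / Real.sqrt κ)) := by
  have h := (hf.comp (tendsto_id.const_mul_atTop hκ)).norm.div_const (Real.sqrt κ)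
  refine h.congr fun R => ?_
  have := (Real.sqrt_pos.2 hκ).ne'
  simp only [Function.comp_apply, norm_mul, norm_waveScale, Real.sqrt_mul hκ.le, id]
  field_simp

theorem tendsto_norm_leadCoeff (B : Background) {K : ℕ} (a : BlockIdx K) :
    ∃ c : ℝ, 0 < c ∧ Tendsto (fun R => Real.sqrt R * ‖leadCoeff B R a‖) atTop (𝓝 c) := by
  have key : ∀ (κ : ℝ) (m : ℤ), 0 < κ → ∃ c : ℝ, 0 < c ∧
      Tendsto (fun R => Real.sqrt R * ‖(κ : ℂ) * deriv (hankel1 m) (κ * R)‖) atTop (𝓝 c) := by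
    intro κ m hκ
    refine ⟨κ * (‖Complex.I * hankelLim m‖ / Real.sqrt κ), ?_, ?_⟩
    · have := norm_pos_iff.2 (mul_ne_zero Complex.I_ne_zero (hankelLim_ne_zero m))
      positivity
    · refine ((tendsto_sqrt_mul_norm_comp hκ (tendsto_deriv_hankel1 m)).const_mul κ).congr
        fun R => ?_
      rw [norm_mul, Complex.norm_real, Real.norm_of_nonneg hκ.le]
      ring
  rcases a with i | i
  · exact key _ _ (B.kappa_pos _)
  · simpa only [leadCoeff, Sum.elim_inr, hS, neg_mul, norm_neg] using
      key _ (order K i) (B.kappa_pos WaveMode.S)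

theorem tendsto_norm_angular (m : ℤ) {κ : ℝ} (hκ : 0 < κ) :
    Tendsto (fun R : ℝ => Real.sqrt R * ‖Complex.I * m / R * hankel1 m (κ * R)‖) atTop (𝓝 0) := by
  have h := (tendsto_sqrt_mul_norm_comp hκ (tendsto_hankel1 m)).mul
    (((tendsto_const_nhds (x := |(m : ℝ)|)).div_atTop tendsto_id))
  rw [mul_zero] at h
  refine h.congr' ?_
  filter_upwards [eventually_gt_atTop 0] with R hR
  rw [norm_mul, norm_div, norm_mul, Complex.norm_I, Complex.norm_real, Real.norm_of_nonneg hR.le,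
    Complex.norm_intCast, id]
  ring

theorem eventually_leadCoeff_ne_zero (B : Background) (K : ℕ) :
    ∀ᶠ R : ℝ in atTop, ∀ a : BlockIdx K, leadCoeff B R a ≠ 0 := by
  rw [eventually_all]
  intro a
  obtain ⟨c, hc, h⟩ := tendsto_norm_leadCoeff B a
  filter_upwards [h.eventually (lt_mem_nhds hc)] with R hR h0
  simp [h0] at hR

theorem tendsto_norm_div_leadCoeff (B : Background) {K : ℕ} (b : BlockIdx K) {f : ℝ → ℂ} {l : ℝ}
    (hf : Tendsto (fun R => Real.sqrt R * ‖f R‖) atTop (𝓝 l)) :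
    ∃ l' : ℝ, (l = 0 → l' = 0) ∧ Tendsto (fun R => ‖f R / leadCoeff B R b‖) atTop (𝓝 l') := by
  obtain ⟨c, hc, h⟩ := tendsto_norm_leadCoeff B b
  refine ⟨l / c, fun h => by simp [h], (hf.div h hc.ne').congr' ?_⟩
  filter_upwards [eventually_gt_atTop 0] with R hR
  rw [norm_div, Pi.div_apply, mul_div_mul_left _ _ (Real.sqrt_pos.2 hR).ne']

theorem tendsto_angular_div_leadCoeff (B : Background) {K : ℕ} (b : BlockIdx K) (m : ℤ) {κ : ℝ}
    (hκ : 0 < κ) :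
    Tendsto (fun R : ℝ => Complex.I * m / R * hankel1 m (κ * R) / leadCoeff B R b) atTop
      (𝓝 0) := by
  obtain ⟨l, hl, h⟩ := tendsto_norm_div_leadCoeff B b (tendsto_norm_angular m hκ)
  rw [hl rfl] at h
  exact tendsto_zero_iff_norm_tendsto_zero.2 h

/-- Between P and S this quotient keeps rotating as `R` grows; boundedness suffices, as it will only
multiply a null factor. -/
theorem isBoundedUnder_leadCoeff_div (B : Background) {K : ℕ} (a b : BlockIdx K) :
    IsBoundedUnder (· ≤ ·) atTop fun R : ℝ => ‖leadCoeff B R a / leadCoeff B R b‖ := by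
  obtain ⟨c, -, h⟩ := tendsto_norm_leadCoeff B a
  obtain ⟨l, -, h'⟩ := tendsto_norm_div_leadCoeff B b h
  exact h'.isBoundedUnder_le

/-- The entries of the normalized Gram matrix of `Y` converge to those of the identity. -/
theorem tendsto_normalized_gram_entry (B : Background) {K : ℕ} (a b : BlockIdx K) :
    Tendsto (fun R : ℝ => if BlockIdx.pos a = BlockIdx.pos b then
        (radAt B R a * (starRingEnd ℂ) (radAt B R b) + tanAt B R a * (starRingEnd ℂ) (tanAt B R b))
          * (leadCoeff B R b * (starRingEnd ℂ) (leadCoeff B R b))⁻¹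
      else 0) atTop (𝓝 ((1 : Matrix (BlockIdx K) (BlockIdx K) ℂ) a b)) := by
  have hκ := B.kappa_pos
  split_ifs with hpos
  · have split : ∀ R : ℝ, radAt B R a / leadCoeff B R b
          * (starRingEnd ℂ) (radAt B R b / leadCoeff B R b)
        + tanAt B R a / leadCoeff B R b * (starRingEnd ℂ) (tanAt B R b / leadCoeff B R b)
        = (radAt B R a * (starRingEnd ℂ) (radAt B R b)
          + tanAt B R a * (starRingEnd ℂ) (tanAt B R b))
          * (leadCoeff B R b * (starRingEnd ℂ) (leadCoeff B R b))⁻¹ := by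
      intro R
      rw [map_div₀, map_div₀, mul_inv]
      ring
    refine Tendsto.congr split ?_
    have hself : ∀ c : BlockIdx K,
        Tendsto (fun R : ℝ => leadCoeff B R c / leadCoeff B R c) atTop (𝓝 1) := fun c => by
      refine tendsto_const_nhds.congr' ?_
      filter_upwards [eventually_leadCoeff_ne_zero B K] with R hR
      rw [div_self (hR c)]
    have hradP : ∀ i, Tendsto (fun R : ℝ => radAt B R (Sum.inl i : BlockIdx K)
        / leadCoeff B R (Sum.inl i : BlockIdx K)) atTop (𝓝 1) := fun i => hself (Sum.inl i)
    have htanS : ∀ i, Tendsto (fun R : ℝ => tanAt B R (Sum.inr i : BlockIdx K)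
        / leadCoeff B R (Sum.inr i : BlockIdx K)) atTop (𝓝 1) := fun i => hself (Sum.inr i)
    have htanP : ∀ i (c : BlockIdx K), Tendsto (fun R : ℝ => tanAt B R (Sum.inl i : BlockIdx K)
        / leadCoeff B R c) atTop (𝓝 0) := fun i c =>
      tendsto_angular_div_leadCoeff B c (order K i) (hκ WaveMode.P)
    have hradS : ∀ i (c : BlockIdx K), Tendsto (fun R : ℝ => radAt B R (Sum.inr i : BlockIdx K)
        / leadCoeff B R c) atTop (𝓝 0) := fun i c =>
      tendsto_angular_div_leadCoeff B c (order K i) (hκ WaveMode.S)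
    have conj : ∀ {f : ℝ → ℂ} {c : ℂ}, Tendsto f atTop (𝓝 c) →
        Tendsto (fun R => (starRingEnd ℂ) (f R)) atTop (𝓝 ((starRingEnd ℂ) c)) :=
      fun h => (Complex.continuous_conj.tendsto _).comp h
    rcases a with i | i <;> rcases b with j | j <;> obtain rfl : i = j := hpos
    · have := ((hradP i).mul (conj (hradP i))).add
        ((htanP i (Sum.inl i)).mul (conj (htanP i (Sum.inl i))))
      simpa only [map_one, map_zero, mul_one, mul_zero, add_zero, Matrix.one_apply_eq] using this
    -- In a P–S entry each of the two products contains one angular coefficient, which tends to `0`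
    -- after normalization; the other factor stays bounded.
    · have h0 := conj (hradS i (Sum.inr i))
      rw [map_zero] at h0
      have h1 := isBoundedUnder_le_mul_tendsto_zero
        (isBoundedUnder_leadCoeff_div B (Sum.inl i : BlockIdx K) (Sum.inr i)) h0
      have := h1.add ((htanP i (Sum.inr i)).mul (conj (htanS i)))
      rw [zero_mul, add_zero] at this
      rw [Matrix.one_apply_ne Sum.inl_ne_inr]
      exact this
    · have h0 := conj (htanP i (Sum.inl i))
      rw [map_zero] at h0
      have h1 := isBoundedUnder_le_mul_tendsto_zero
        (isBoundedUnder_leadCoeff_div B (Sum.inr i : BlockIdx K) (Sum.inl i)) h0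
      have := ((hradS i (Sum.inl i)).mul (conj (hradP i))).add h1
      rw [zero_mul, add_zero] at this
      rw [Matrix.one_apply_ne Sum.inr_ne_inl]
      exact this
    · have := ((hradS i (Sum.inr i)).mul (conj (hradS i (Sum.inr i)))).add
        ((htanS i).mul (conj (htanS i)))
      simpa only [map_one, map_zero, mul_one, mul_zero, zero_add, Matrix.one_apply_eq] using this
  · rw [Matrix.one_apply_ne (fun h => hpos (congrArg BlockIdx.pos h))]
    exact tendsto_const_nhds

/-! ### The normalized Gram matrix and self-adjointness -/

theorem eventually_ZY_inv (B : Background) (K : ℕ) :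
    ∀ᶠ R : ℝ in atTop, IsUnit (ZY B K R) ∧ (ZY B K R)⁻¹ = Matrix.diagonal
      fun a => (leadCoeff B R a * (starRingEnd ℂ) (leadCoeff B R a))⁻¹ := by
  filter_upwards [eventually_leadCoeff_ne_zero B K] with R hR
  have h : ZY B K R * Matrix.diagonal
      (fun a => (leadCoeff B R a * (starRingEnd ℂ) (leadCoeff B R a))⁻¹) = 1 := by
    rw [ZY_eq_diagonal, Matrix.diagonal_mul_diagonal, ← Matrix.diagonal_one]
    congr 1
    funext a
    exact mul_inv_cancel₀ (mul_ne_zero (hR a) ((map_ne_zero _).2 (hR a)))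
  exact ⟨IsUnit.of_mul_eq_one _ h, Matrix.inv_eq_right_inv h⟩

theorem eventually_differentiableAt_hankel1 (B : Background) (K : ℕ) :
    ∀ᶠ R : ℝ in atTop, ∀ a : BlockIdx K,
      DifferentiableAt ℝ (hankel1 (order K (BlockIdx.pos a))) (B.kappa (BlockIdx.mode a) * R) := by
  rw [eventually_all]
  intro a
  filter_upwards [(tendsto_id.const_mul_atTop (B.kappa_pos (BlockIdx.mode a))).eventually
    (eventually_gt_atTop (|(order K (BlockIdx.pos a) : ℝ)| + 2))] with R hR
  exact (hasDerivAt_hankel1 _ hR).differentiableAt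

theorem tendsto_normalized_gram (B : Background) {K Nr : ℕ} (hNr : 2 * K + 1 ≤ Nr)
    {d dperp : Fin Nr → Plane} (hd : ∀ r, ‖d r‖ = 1) (hdperp : ∀ r, ‖dperp r‖ = 1)
    (horth : ∀ r, inner ℝ (d r) (dperp r) = 0) :
    Tendsto (fun R : ℝ => (Nr : ℂ)⁻¹ • ((Ymat B K Nr d dperp R).conjTranspose
      * Ymat B K Nr d dperp R * (ZY B K R)⁻¹)) atTop (𝓝 1) := by
  refine tendsto_pi_nhds.2 fun a => tendsto_pi_nhds.2 fun b => ?_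
  refine (tendsto_normalized_gram_entry B a b).congr' ?_
  filter_upwards [eventually_ZY_inv B K, eventually_differentiableAt_hankel1 B K,
    eventually_gt_atTop 0] with R hZ hH hR
  have hN : (Nr : ℂ) ≠ 0 := Nat.cast_ne_zero.2 (by omega)
  rw [hZ.2, Matrix.smul_apply, Matrix.mul_diagonal,
    Ymat_conjTranspose_mul_self_apply B hNr hd hdperp horth hR hH, smul_eq_mul]
  split_ifs
  · rw [mul_assoc, inv_mul_cancel_left₀ hN]
  · simp

theorem Ldag_Lop (B : Background) {K Ns Nr : ℕ} (hNs : 2 * K + 1 ≤ Ns) (θ₀ : ℝ)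
    (d dperp : Fin Nr → Plane) (R : ℝ) (M : Matrix (BlockIdx K) (BlockIdx K) ℂ) :
    Ldag B K Ns Nr θ₀ d dperp R (Lop B K Ns Nr θ₀ d dperp R M)
      = M * ((Nr : ℂ)⁻¹ • ((Ymat B K Nr d dperp R).conjTranspose
        * Ymat B K Nr d dperp R * (ZY B K R)⁻¹)) := by
  have hN : (Ns : ℂ) ≠ 0 := Nat.cast_ne_zero.2 (by omega)
  have hX : (ZX B K)⁻¹ * (Xmat B K Ns θ₀).conjTranspose * Xmat B K Ns θ₀ = (Ns : ℂ) • 1 := by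
    rw [Matrix.mul_assoc, Xmat_conjTranspose_mul_self B hNs, Matrix.mul_smul,
      Matrix.nonsing_inv_mul _ ((Matrix.isUnit_iff_isUnit_det _).1 (isUnit_ZX B K))]
  simp only [Ldag, Lop, LinearMap.coe_mk, AddHom.coe_mk]
  rw [show (ZX B K)⁻¹ * (Xmat B K Ns θ₀).conjTranspose
      * (Xmat B K Ns θ₀ * M * (Ymat B K Nr d dperp R).conjTranspose) * Ymat B K Nr d dperp R
      * (ZY B K R)⁻¹ = ((ZX B K)⁻¹ * (Xmat B K Ns θ₀).conjTranspose * Xmat B K Ns θ₀)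
        * (M * ((Ymat B K Nr d dperp R).conjTranspose * Ymat B K Nr d dperp R * (ZY B K R)⁻¹)) by
    simp only [Matrix.mul_assoc], hX, Matrix.smul_mul, Matrix.one_mul, smul_smul, Matrix.mul_smul]
  congr 1
  field_simp

theorem frobInner_mul_mul {m n : Type*} [Fintype m] [Fintype n] {P : Matrix m m ℂ}
    {Q : Matrix n n ℂ} (hP : P.IsHermitian) (hQ : Q.IsHermitian) (A A' : Matrix m n ℂ) :
    frobInner (P * A * Q) A' = frobInner A (P * A' * Q) := by
  rw [frobInner, frobInner, Matrix.conjTranspose_mul, Matrix.conjTranspose_mul, hP.eq, hQ.eq,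
    Matrix.mul_assoc, Matrix.trace_mul_comm]
  simp only [Matrix.mul_assoc]

theorem isHermitian_mul_inv_mul_conjTranspose {m n : Type*} [Fintype n] [DecidableEq n]
    (X : Matrix m n ℂ) {Z : Matrix n n ℂ} (hZ : Z.IsHermitian) :
    (X * Z⁻¹ * X.conjTranspose).IsHermitian :=
  Matrix.isHermitian_mul_mul_conjTranspose X hZ.inv

/-- `L L†` is a real multiple of `A ↦ (X Z_X⁻¹ X^*) A (Y Z_Y⁻¹ Y^*)`, with Hermitian outer factors.
This holds at every `R`: where `ZY` is singular its `⁻¹` is `0`, still Hermitian. -/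
theorem frobInner_Lop_Ldag (B : Background) (K Ns Nr : ℕ) (θ₀ : ℝ) (d dperp : Fin Nr → Plane)
    (R : ℝ) (A A' : Matrix (Fin Ns ⊕ Fin Ns) (Fin Nr ⊕ Fin Nr) ℂ) :
    frobInner (Lop B K Ns Nr θ₀ d dperp R (Ldag B K Ns Nr θ₀ d dperp R A)) A' =
      frobInner A (Lop B K Ns Nr θ₀ d dperp R (Ldag B K Ns Nr θ₀ d dperp R A')) := by
  have hZX : (ZX B K).IsHermitian := by
    rw [ZX_eq_diagonal, Matrix.isHermitian_diagonal_iff]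
    intro a
    rw [isSelfAdjoint_iff, Complex.star_def, map_inv₀, Complex.conj_ofReal]
  have hZY : (ZY B K R).IsHermitian := by
    rw [ZY_eq_diagonal, Matrix.isHermitian_diagonal_iff]
    intro a
    rw [isSelfAdjoint_iff, Complex.star_def, map_mul, Complex.conj_conj, mul_comm]
  have e : ∀ A, Lop B K Ns Nr θ₀ d dperp R (Ldag B K Ns Nr θ₀ d dperp R A)
      = (1 / ((Ns : ℂ) * Nr)) • ((Xmat B K Ns θ₀ * (ZX B K)⁻¹ * (Xmat B K Ns θ₀).conjTranspose) * A
        * (Ymat B K Nr d dperp R * (ZY B K R)⁻¹ * (Ymat B K Nr d dperp R).conjTranspose)) := by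
    intro A
    simp only [Ldag, Lop, LinearMap.coe_mk, AddHom.coe_mk, Matrix.mul_smul, Matrix.smul_mul,
      Matrix.mul_assoc]
  have hc : star (1 / ((Ns : ℂ) * Nr)) = 1 / ((Ns : ℂ) * Nr) := by simp
  have h := frobInner_mul_mul (isHermitian_mul_inv_mul_conjTranspose (Xmat B K Ns θ₀) hZX)
    (isHermitian_mul_inv_mul_conjTranspose (Ymat B K Nr d dperp R) hZY) A A'
  rw [frobInner, frobInner] at h
  rw [e, e, frobInner, frobInner, Matrix.conjTranspose_smul, Matrix.smul_mul, Matrix.trace_smul,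
    Matrix.mul_smul, Matrix.trace_smul, hc, h]

end ElasticScattering

open ElasticScattering in
theorem theorem4p3 (B : Background) (K Ns Nr : ℕ)
    (hNs : 2 * K + 1 ≤ Ns) (hNr : 2 * K + 1 ≤ Nr)
    (θ₀ : ℝ) (d dperp : Fin Nr → Plane)
    (hd : ∀ r, ‖d r‖ = 1) (hdperp : ∀ r, ‖dperp r‖ = 1)
    (horth : ∀ r, inner ℝ (d r) (dperp r) = 0)
    (hX : (Xmat B K Ns θ₀).rank = 4 * K + 2)
    (hY : ∀ᶠ R : ℝ in atTop, (Ymat B K Nr d dperp R).rank = 4 * K + 2) :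
    IsUnit (ZX B K) ∧
    (∀ᶠ R : ℝ in atTop, IsUnit (ZY B K R)) ∧
    (∀ M : Matrix (BlockIdx K) (BlockIdx K) ℂ,
      Tendsto (fun R : ℝ => Ldag B K Ns Nr θ₀ d dperp R (Lop B K Ns Nr θ₀ d dperp R M))
        atTop (𝓝 M)) ∧
    (∀ᶠ R : ℝ in atTop, ∀ A A' : Matrix (Fin Ns ⊕ Fin Ns) (Fin Nr ⊕ Fin Nr) ℂ,
      frobInner (Lop B K Ns Nr θ₀ d dperp R (Ldag B K Ns Nr θ₀ d dperp R A)) A' =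
        frobInner A (Lop B K Ns Nr θ₀ d dperp R (Ldag B K Ns Nr θ₀ d dperp R A'))) := by
  refine ⟨isUnit_ZX B K, (eventually_ZY_inv B K).mono fun R h => h.1, fun M => ?_,
    Eventually.of_forall fun R => frobInner_Lop_Ldag B K Ns Nr θ₀ d dperp R⟩
  -- Left multiplication by `M` is continuous, so convergence of the normalized Gram matrix to `1`
  -- gives convergence to `M`.
  have h := ((continuous_const (y := M)).matrix_mul continuous_id).tendsto
    (1 : Matrix (BlockIdx K) (BlockIdx K) ℂ)
  simp only [id, Matrix.mul_one] at h
  refine (h.comp (tendsto_normalized_gram B hNr hd hdperp horth)).congr fun R => ?_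
  rw [Ldag_Lop B hNs]
  rfl
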